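/- Let $\Gamma$ be a finite oriented graph with vertex set $V$ and edge set $E$ (multiple edges, and edges starting and ending at the same vertex, are allowed). Each $e\in E$ has a starting vertex $s(e)$ and a terminal vertex $t(e)$; its reversal $e^{-1}$ has $s(e^{-1})=t(e)$, $t(e^{-1})=s(e)$. For every vertex $v$ and all directed edges $a,b\in\{e,e^{-1}:e\in E\}$ with $s(a)=s(b)=v$, let $\tau^v_{ab}\in\mathbb{C}$ be parameters with $\tau^v_{ab}=-\tau^v_{ba}$. *Generating functional.* For spinors $z=(z_0,z_1),w=(w_0,w_1)\in\mathbb{C}^2$ put $[z|w\rangle=z_0w_1-z_1w_0$, $\check z=(-\overline{z_1},\overline{z_0})$ and $d\mu(z)=\pi^{-2}e^{-|z_0|^2-|z_1|^2}\,d^4z$. Given $w=(w_e)_{e\in E}\in(\mathbb{C}^2)^E$ put $w_{e^{-1}}=\check w_e$. For a vertex $v$, list the directed edges starting at $v$ (the outgoing edges $e$, and $e^{-1}$ for the incoming edges $e$) in some order $a_1,\dots,a_n$, and let $$\mathcal{C}^{(v)}_{\tau}(w)=\exp\Big(\sum_{i<j}\tau^v_{a_ia_j}[w_{a_i}|w_{a_j}\rangle\Big),\qquad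 \mathcal{G}_\Gamma(\tau)=\int\prod_{e\in E}d\mu(w_e)\prod_{v\in V}\mathcal{C}^{(v)}_\tau(w).$$ *Simple loops.* A simple loop $\ell=(e_1,\dots,e_n)$, $n\ge 1$, is a cyclic sequence of directed edges with $t(e_i)=s(e_{i+1})$ and $t(e_n)=s(e_1)$ that uses each edge of $\Gamma$ at most once, in either direction (vertices may be repeated). Simple loops are considered up to the choice of the starting point and of the direction of traversal. Put $$A_\ell(\tau)=-(-1)^{|e|}\,\tau^{s(e_2)}_{e_1^{-1}e_2}\,\tau^{s(e_3)}_{e_2^{-1}e_3}\cdots\tau^{s(e_1)}_{e_n^{-1}e_1},$$ where $|e|$ is the number of edges of $\ell$ traversed in agreement with the orientation of $\Gamma$; this depends neither on the starting point nor on the direction. Two simple loops are disjoint if they have no edge in common (they may share vertices). For a collection $L=\{\ell_1,\dots,\ell_k\}$, $k\ge1$, of pairwise disjoint simple loops put $A_L(\tau)=A_{\ell_1}(\tau)\cdots A_{\ell_k}(\tau)$. **Theorem.** The integral defining $\mathcal{G}_\Gamma(\tau)$ converges absolutely for all sufficiently small $\tau$, and for every $\tau$ for which it converges absolutely one has $1+\sum_L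 A_L(\tau)\neq0$ and $$\mathcal{G}_\Gamma(\tau)=\frac{1}{\big(1+\sum_L A_L(\tau)\big)^2},$$ where the sum is over all collections $L$ of pairwise disjoint simple loops of $\Gamma$. -/

import Mathlib

open MeasureTheory

/-! ### Spinors -/

/-- A spinor `|z⟩ = (z₀, z₁)` in `ℂ²`. -/
abbrev Spinor : Type := Fin 2 → ℂ

namespace Spinor

/-- The holomorphic invariant `[z|w⟩ = z₀ w₁ - z₁ w₀`. -/
def bracket (z w : Spinor) : ℂ := z 0 * w 1 - z 1 * w 0

/-- The conjugate spinor `ž = |z] = (-conj z₁, conj z₀)`. -/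
def check (z : Spinor) : Spinor := ![-(starRingEnd ℂ (z 1)), starRingEnd ℂ (z 0)]

/-- The Gaussian measure `dμ(z) = π⁻² exp(-⟨z|z⟩) d⁴z`, with `d⁴z` the Lebesgue measure on `ℂ²`. -/
noncomputable def gaussian : Measure Spinor :=
  (volume : Measure Spinor).withDensity fun z =>
    ENNReal.ofReal (Real.exp (-(‖z 0‖ ^ 2 + ‖z 1‖ ^ 2)) / Real.pi ^ 2)

/-- The functional `𝒞_τ(z₁, …, zₙ) = exp (∑_{i<j} τ_{ij} [z_i|z_j⟩)`. -/
noncomputable def genIntertwiner {n : ℕ} (τ : Fin n → Fin n → ℂ) (z : Fin n → Spinor) : ℂ :=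
  Complex.exp (∑ i, ∑ j ∈ Finset.Ioi i, τ i j * bracket (z i) (z j))

end Spinor

/-! ### Oriented graphs -/

/-- An oriented graph with vertex set `V` and edge set `E`; several edges between the same
vertices and edges that start and end at the same vertex are allowed. -/
structure OrientedGraph (V E : Type*) where
  /-- The starting vertex of an edge. -/
  source : E → V
  /-- The terminal vertex of an edge. -/
  target : E → V

/-- An edge with a direction of traversal: `(e, true)` is `e` traversed along its orientation,
`(e, false)` is the reversed edge `e⁻¹`. -/
abbrev DirEdge (E : Type*) : Type _ := E × Bool

/-- The reversal `e ↦ e⁻¹`. -/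
def DirEdge.inv {E : Type*} (a : DirEdge E) : DirEdge E := (a.1, !a.2)

@[simp] theorem DirEdge.inv_inv {E : Type*} (a : DirEdge E) : a.inv.inv = a := by
  simp [DirEdge.inv]

@[simp] theorem DirEdge.inv_fst {E : Type*} (a : DirEdge E) : a.inv.1 = a.1 := rfl

namespace OrientedGraph

variable {V E : Type*}

/-- Starting vertex of a directed edge, `s(e⁻¹) = t(e)`. -/
def s (Γ : OrientedGraph V E) (a : DirEdge E) : V := if a.2 then Γ.source a.1 else Γ.target a.1

/-- Terminal vertex of a directed edge, `t(e⁻¹) = s(e)`. -/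
def t (Γ : OrientedGraph V E) (a : DirEdge E) : V := if a.2 then Γ.target a.1 else Γ.source a.1

@[simp] theorem s_inv (Γ : OrientedGraph V E) (a : DirEdge E) : Γ.s a.inv = Γ.t a := by
  rcases a with ⟨e, _ | _⟩ <;> rfl

@[simp] theorem t_inv (Γ : OrientedGraph V E) (a : DirEdge E) : Γ.t a.inv = Γ.s a := by
  rcases a with ⟨e, _ | _⟩ <;> rfl

/-- The parameters `τ^v_{ab} = -τ^v_{ba} ∈ ℂ`, for directed edges `a, b` starting at `v`
(an incoming edge `e` of `v` enters as `e⁻¹`). Values `val v a b` for other `a, b` are never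
constrained. -/
structure Weights (Γ : OrientedGraph V E) where
  val : V → DirEdge E → DirEdge E → ℂ
  antisymm : ∀ v a b, Γ.s a = v → Γ.s b = v → val v a b = -val v b a

/-- The directed edges starting at `v`: outgoing edges `e`, and `e⁻¹` for the incoming ones. -/
abbrev Star (Γ : OrientedGraph V E) (v : V) : Type _ := {a : DirEdge E // Γ.s a = v}

/-- The spinor carried by a directed edge: `w_e` for `e` and `w̌_e` for `e⁻¹`. -/
def spinorAt (w : E → Spinor) (a : DirEdge E) : Spinor :=
  if a.2 then w a.1 else Spinor.check (w a.1)

/-- The functional `𝒞^{(v)}_{τ^v}(w)` of the vertex `v`; `ord` lists the edges at `v`. -/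
noncomputable def vertexIntertwiner (Γ : OrientedGraph V E) (τ : Γ.Weights) (v : V) {n : ℕ}
    (ord : Fin n ≃ Γ.Star v) (w : E → Spinor) : ℂ :=
  Spinor.genIntertwiner (fun i j => τ.val v (ord i).1 (ord j).1)
    (fun i => spinorAt w (ord i).1)

/-- The integrand `∏_v 𝒞^{(v)}_{τ^v}(w)` of the generating functional. -/
noncomputable def integrand [Fintype V] (Γ : OrientedGraph V E) (τ : Γ.Weights) (n : V → ℕ)
    (ord : ∀ v, Fin (n v) ≃ Γ.Star v) (w : E → Spinor) : ℂ :=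
  ∏ v, Γ.vertexIntertwiner τ v (ord v) w

/-- The measure `∏_e dμ(w_e)`. -/
noncomputable def edgeMeasure (E : Type*) [Fintype E] : Measure (E → Spinor) :=
  Measure.pi fun _ => Spinor.gaussian

/-- The generating functional `𝒢_Γ(τ) = ∫ ∏_e dμ(w_e) ∏_v 𝒞^{(v)}_{τ^v}(w)`. -/
noncomputable def genFunctional [Fintype V] [Fintype E] (Γ : OrientedGraph V E) (τ : Γ.Weights)
    (n : V → ℕ) (ord : ∀ v, Fin (n v) ≃ Γ.Star v) : ℂ :=
  ∫ w, Γ.integrand τ n ord w ∂(edgeMeasure E)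

/-! ### Simple loops -/

/-- A simple loop with a direction of traversal: a nonempty cyclic sequence of directed edges
`e₁, …, e_n` with `t(e_i) = s(e_{i+1})`, `t(e_n) = s(e_1)`, using each edge of `Γ` at most once
(in either direction). Vertices may be repeated. -/
def IsSimpleLoop (Γ : OrientedGraph V E) (c : Cycle (DirEdge E)) : Prop :=
  c ≠ Cycle.nil ∧ c.Chain (fun a b => Γ.t a = Γ.s b) ∧ (c.map Prod.fst).Nodup

/-- Simple loops together with a direction of traversal. -/
abbrev DirLoop (Γ : OrientedGraph V E) : Type _ := {c : Cycle (DirEdge E) // Γ.IsSimpleLoop c}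

/-- The same cyclic sequence of edges traversed backwards: `(e_n⁻¹, …, e_1⁻¹)`. -/
def revCycle (c : Cycle (DirEdge E)) : Cycle (DirEdge E) := (c.map DirEdge.inv).reverse

theorem revCycle_coe (l : List (DirEdge E)) :
    revCycle (l : Cycle (DirEdge E)) = ((l.map DirEdge.inv).reverse : List (DirEdge E)) := rfl

theorem revCycle_revCycle (c : Cycle (DirEdge E)) : revCycle (revCycle c) = c := by
  induction c using Quotient.inductionOn' with
  | h l =>
    rw [Cycle.mk''_eq_coe, revCycle_coe, revCycle_coe]
    simp [Function.comp_def]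

/-- Two directed simple loops are identified when they differ by the direction of traversal. -/
instance loopSetoid (Γ : OrientedGraph V E) : Setoid Γ.DirLoop where
  r c d := d.1 = c.1 ∨ d.1 = revCycle c.1
  iseqv :=
    { refl := fun _ => Or.inl rfl
      symm := by
        rintro c d (h | h)
        · exact Or.inl h.symm
        · exact Or.inr (by rw [h, revCycle_revCycle])
      trans := by
        rintro c d e (h | h) (h' | h')
        · exact Or.inl (h'.trans h)
        · exact Or.inr (by rw [h', h])
        · exact Or.inr (by rw [h', h])
        · exact Or.inl (by rw [h', h, revCycle_revCycle]) }

/-- The simple loops of `Γ`, up to the choice of the starting point and of the direction. -/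
def SimpleLoop (Γ : OrientedGraph V E) : Type _ := Quotient Γ.loopSetoid

instance [Finite E] (Γ : OrientedGraph V E) : Finite Γ.DirLoop := by
  classical
  have := Fintype.ofFinite E
  refine Finite.of_injective
    (fun c : Γ.DirLoop => (⟨c.1, ?_⟩ : {c : Cycle (DirEdge E) // c.Nodup})) ?_
  · obtain ⟨c, -, -, h⟩ := c
    induction c using Quotient.inductionOn' with
    | h l => exact List.Nodup.of_map _ h
  · intro c d h
    exact Subtype.ext (congrArg (fun x => x.1) h)

instance [Finite E] (Γ : OrientedGraph V E) : Finite Γ.SimpleLoop :=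
  inferInstanceAs (Finite (Quotient Γ.loopSetoid))

noncomputable instance [Finite E] (Γ : OrientedGraph V E) : Fintype Γ.SimpleLoop :=
  Fintype.ofFinite _

theorem mem_map_fst_revCycle (c : Cycle (DirEdge E)) (e : E) :
    e ∈ (revCycle c).map Prod.fst ↔ e ∈ c.map Prod.fst := by
  induction c using Quotient.inductionOn' with
  | h l =>
    rw [Cycle.mk''_eq_coe, revCycle_coe]
    simp [Function.comp_def]

/-- The set of edges of `Γ` used by a simple loop. -/
def SimpleLoop.edges {Γ : OrientedGraph V E} : Γ.SimpleLoop → Set E :=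
  Quotient.lift (fun c : Γ.DirLoop => {e | e ∈ c.1.map Prod.fst}) (by
    rintro c d (h | h)
    · simp only [h]
    · simp only [h, mem_map_fst_revCycle])

/-- For a closed sequence `e₁, …, e_n` of directed edges, the quantity
`-(-1)^{|e|} τ^{s(e₂)}_{e₁⁻¹ e₂} τ^{s(e₃)}_{e₂⁻¹ e₃} ⋯ τ^{s(e₁)}_{e_n⁻¹ e₁}`, where `|e|` is the
number of `i` for which `e_i` agrees with the orientation of `Γ`. -/
def listAmplitude {Γ : OrientedGraph V E} (τ : Γ.Weights) (l : List (DirEdge E)) : ℂ :=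
  -(-1) ^ (l.countP fun a => a.2) *
    (List.zipWith (fun a b => τ.val (Γ.s b) a.inv b) l (l.rotate 1)).prod

theorem listAmplitude_rotate {Γ : OrientedGraph V E} (τ : Γ.Weights) {l l' : List (DirEdge E)}
    (h : l ~r l') : listAmplitude τ l = listAmplitude τ l' := by
  unfold listAmplitude
  rw [h.perm.countP_eq]
  congr 1
  obtain ⟨k, rfl⟩ := h
  rw [List.rotate_rotate, Nat.add_comm, ← List.rotate_rotate,
    ← List.zipWith_rotate_distrib _ _ _ _ (by simp)]
  exact (List.rotate_perm _ _).prod_eq.symm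

/-- The amplitude of a cyclic sequence of directed edges. -/
def cycleAmplitude {Γ : OrientedGraph V E} (τ : Γ.Weights) : Cycle (DirEdge E) → ℂ :=
  Quotient.lift (listAmplitude τ) fun _ _ h => listAmplitude_rotate τ h

theorem forall₂_rotate_of_chain {α : Type*} {R : α → α → Prop} {l : List α}
    (h : (l : Cycle α).Chain R) : List.Forall₂ R l (l.rotate 1) := by
  have key : ∀ (l : List α) (a b : α), List.IsChain R (a :: (l ++ [b])) →
      List.Forall₂ R (a :: l) (l ++ [b]) := by
    intro l
    induction l with
    | nil => intro a b h; simpa using h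
    | cons x l ih =>
      intro a b h
      rw [List.cons_append, List.isChain_cons_cons] at h
      exact List.Forall₂.cons h.1 (ih x b h.2)
  cases l with
  | nil => simp
  | cons a l =>
    rw [Cycle.chain_coe_cons] at h
    simpa using key l a a h

theorem prod_zipWith_neg {α : Type*} {R : α → α → Prop} {f g : α → α → ℂ}
    (hfg : ∀ a b, R a b → g a b = -f a b) {l l' : List α} (h : List.Forall₂ R l l') :
    (List.zipWith g l l').prod = (-1) ^ l.length * (List.zipWith f l l').prod := by
  induction h with
  | nil => simp
  | cons hab _ ih => simp [ih, hfg _ _ hab]; ring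

theorem cycleAmplitude_revCycle {Γ : OrientedGraph V E} (τ : Γ.Weights)
    (c : Cycle (DirEdge E)) (hc : c.Chain fun a b => Γ.t a = Γ.s b) :
    cycleAmplitude τ (revCycle c) = cycleAmplitude τ c := by
  induction c using Quotient.inductionOn' with
  | h l =>
    rw [Cycle.mk''_eq_coe] at hc ⊢
    rw [revCycle_coe]
    change listAmplitude τ (l.map DirEdge.inv).reverse = listAmplitude τ l
    have hrot : ((l.map DirEdge.inv).rotate 1).reverse.rotate 1 =
        (l.map DirEdge.inv).reverse := by
      cases l <;> simp
    have h1 : ((l.map DirEdge.inv).rotate 1).reverse ~r (l.map DirEdge.inv).reverse := ⟨1, hrot⟩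
    rw [← listAmplitude_rotate τ h1]
    have hcount : (-1 : ℂ) ^ (l.countP fun a => a.2) =
        (-1) ^ (((l.map DirEdge.inv).rotate 1).reverse.countP fun a => a.2) *
          (-1) ^ l.length := by
      rw [(List.reverse_perm _).countP_eq, (List.rotate_perm _ _).countP_eq]
      clear hc hrot h1
      induction l with
      | nil => simp
      | cons a l ih =>
        rcases a with ⟨e, _ | _⟩ <;> simp [DirEdge.inv, pow_succ, ih]
    unfold listAmplitude
    rw [hcount, hrot, ← List.reverse_zipWith (by simp), List.prod_reverse, List.zipWith_comm,
      ← List.map_rotate, List.zipWith_map,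
      prod_zipWith_neg (f := fun a b => τ.val (Γ.s b) a.inv b) ?_ (forall₂_rotate_of_chain hc)]
    · ring
    · intro a b h
      simp only [DirEdge.inv_inv, s_inv]
      rw [h]
      exact τ.antisymm _ _ _ rfl (by rw [s_inv, h])

/-- The amplitude `A_ℓ(τ)` of a simple loop; it depends neither on the starting point nor on the
direction of traversal. -/
def SimpleLoop.amplitude {Γ : OrientedGraph V E} (τ : Γ.Weights) : Γ.SimpleLoop → ℂ :=
  Quotient.lift (fun c : Γ.DirLoop => cycleAmplitude τ c.1) (by
    rintro c d (h | h)
    · simp only [h]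
    · simp only [h]
      exact (cycleAmplitude_revCycle τ c.1 c.2.2.1).symm)

/-- A collection of disjoint simple loops: a nonempty finite set of simple loops, no two of which
have an edge in common. -/
def IsDisjointCollection {Γ : OrientedGraph V E} (L : Finset Γ.SimpleLoop) : Prop :=
  L.Nonempty ∧ ∀ ℓ ∈ L, ∀ ℓ' ∈ L, ℓ ≠ ℓ' → Disjoint ℓ.edges ℓ'.edges

open Classical in
/-- The sum `∑_L A_L(τ)` over all collections `L = {ℓ₁, …, ℓ_k}` of disjoint simple loops, where
`A_L(τ) = A_{ℓ₁}(τ) ⋯ A_{ℓ_k}(τ)`. -/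
noncomputable def loopSum [Finite E] (Γ : OrientedGraph V E) (τ : Γ.Weights) : ℂ :=
  ∑ L : Finset Γ.SimpleLoop with IsDisjointCollection L, ∏ ℓ ∈ L, ℓ.amplitude τ

end OrientedGraph

/-! The integral is the reciprocal of a determinant, and the loop sum is a Pfaffian of the same
matrix.

Take as coordinates the first component `u a` of the spinor carried by each directed edge `a`. The
second component is, up to sign, the conjugate of `u a.inv` (`spinorAt_one`). Antisymmetry of τ then
turns the whole exponent, Gaussian weight included, into -⟨u, Jᵀ(J - T)u⟩, where J pairs each edge
with its reversal and T collects the weights of all vertices (`density_mul_integrand`). An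
absolutely convergent complex Gaussian integral with matrix M in N complex variables equals π^N /
det M, with det M ≠ 0 (`integral_cexp_neg_dotProduct_mulVec`). Since det J = 1, the functional is 1
/ det(J - T). No continuation from small τ is needed: integrability itself forces the Hermitian part
of M to be positive definite.

The matrix J - T is skew, so its determinant is the square of its Pfaffian
(`pfaffianForm_ιMulti_sq`). Expand the Pfaffian at the reversed half of an edge e. It is paired
either with the other half of e or with half of another edge f, whose second half is then paired in
turn, and so on until the path closes up at e. The J-part of the self-pairing of e removes e; every
other term is a closed path through e using each edge at most once, times the Pfaffian of the unused
edges (`pfaffianForm_edgesWedge_insert_eq_sum`). Sums over collections of disjoint loops obey the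
same recursion, according to which loop, if any, covers e (`collectionSum_insert`,
`sum_simpleLoop_eq_sum_pathLists`). Hence Pf(J - T) = 1 + ∑ A_L. -/

namespace ExteriorAlgebra

/-! ### Contraction in the exterior algebra. -/

variable {R M : Type*} [CommRing R] [AddCommGroup M] [Module R M]

/-- Interior product by a linear functional on the exterior algebra. -/
noncomputable def interior (d : Module.Dual R M) : ExteriorAlgebra R M →ₗ[R] ExteriorAlgebra R M :=
  CliffordAlgebra.contractLeft (Q := (0 : QuadraticForm R M)) d

theorem interior_one (d : Module.Dual R M) : interior d 1 = 0 :=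
  CliffordAlgebra.contractLeft_one (Q := (0 : QuadraticForm R M)) d

theorem interior_ι_mul (d : Module.Dual R M) (m : M) (x : ExteriorAlgebra R M) :
    interior d (ι R m * x) = d m • x - ι R m * interior d x :=
  CliffordAlgebra.contractLeft_ι_mul d m x

theorem ι_mul_ι_swap (m n : M) : ι R m * ι R n = -(ι R n * ι R m) :=
  eq_neg_of_add_eq_zero_left (ι_add_mul_swap m n)

theorem ι_mul_ι_mul_swap (m n : M) (x : ExteriorAlgebra R M) :
    ι R m * (ι R n * x) = -(ι R n * (ι R m * x)) := by
  rw [← mul_assoc, ι_mul_ι_swap, neg_mul, mul_assoc]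

theorem ι_mul_ι_mul_self (m : M) (x : ExteriorAlgebra R M) :
    ι R m * (ι R m * x) = 0 := by
  rw [← mul_assoc, ι_sq_zero, zero_mul]

theorem interior_ιMulti_eq_zero (d : Module.Dual R M) {n : ℕ} (v : Fin n → M)
    (h : ∀ i, d (v i) = 0) : interior d (ιMulti R n v) = 0 := by
  induction n with
  | zero => simp [interior_one]
  | succ n ih =>
    rw [ιMulti_succ_apply, interior_ι_mul, h, zero_smul, ih (Matrix.vecTail v) fun i => h i.succ]
    simp

/-- Multiples of `a` and `b` die against the prefactor a ∧ b. This permits elimination of a pair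
inside a wedge product. -/
theorem ι_mul_ι_mul_ιMulti_add (a b : M) {n : ℕ} (v : Fin n → M) (α β : Fin n → R) :
    ι R a * (ι R b * ιMulti R n fun i => v i + α i • a + β i • b) =
      ι R a * (ι R b * ιMulti R n v) := by
  induction n with
  | zero => simp
  | succ n ih =>
    have key : ∀ (m : M) (x : ExteriorAlgebra R M),
        ι R a * (ι R b * (ι R m * x)) = ι R m * (ι R a * (ι R b * x)) := fun m x => by
      rw [ι_mul_ι_mul_swap b m, mul_neg, ι_mul_ι_mul_swap a m, neg_neg]
    rw [ιMulti_succ_apply, ιMulti_succ_apply, key, key]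
    have := ih (fun i => v i.succ) (fun i => α i.succ) (fun i => β i.succ)
    simp only [Matrix.vecTail, Function.comp_def] at this ⊢
    rw [this, map_add, map_add, add_mul, add_mul, map_smul, map_smul, smul_mul_assoc,
      smul_mul_assoc, ι_mul_ι_mul_self, ι_mul_ι_mul_swap b a, ι_mul_ι_mul_self]
    simp only [neg_zero, mul_zero, smul_zero, add_zero]

end ExteriorAlgebra

/-! ### The Pfaffian as a functional, and its square. -/

section Pfaffian

open CliffordAlgebra

variable {R M : Type*} [CommRing R] [AddCommGroup M] [Module R M]

/-- The Pfaffian functional of an alternating form `B` on the exterior algebra: on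
`v₁ ∧ ⋯ ∧ vₙ` it takes the value `Pf (B vᵢ vⱼ)`. -/
noncomputable def pfaffianForm (B : LinearMap.BilinForm R M) (hB : B.IsAlt) :
    ExteriorAlgebra R M →ₗ[R] R :=
  ExteriorAlgebra.algebraMapInv.toLinearMap ∘ₗ
    changeForm (Q := (0 : QuadraticForm R M)) (Q' := (0 : QuadraticForm R M)) (B := -B)
      (by ext m; simp [hB m])

variable (B : LinearMap.BilinForm R M) (hB : B.IsAlt)

@[simp] theorem pfaffianForm_one : pfaffianForm B hB 1 = 1 := by
  simp only [pfaffianForm, LinearMap.comp_apply]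
  erw [changeForm_one]
  simp

/-- Expansion of the Pfaffian along a row. Changing the form by `-B` turns left multiplication by
`m` into multiplication plus contraction with `B m`, and the multiplication part has no scalar
component. -/
theorem pfaffianForm_ι_mul (m : M) (x : ExteriorAlgebra R M) :
    pfaffianForm B hB (ExteriorAlgebra.ι R m * x) =
      pfaffianForm B hB (ExteriorAlgebra.interior (B m) x) := by
  simp only [pfaffianForm, LinearMap.comp_apply]
  erw [changeForm_ι_mul]
  rw [ExteriorAlgebra.interior, changeForm_contractLeft]
  have h : ExteriorAlgebra.algebraMapInv (R := R) (ExteriorAlgebra.ι R m) = 0 := by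
    simp [ExteriorAlgebra.algebraMapInv]
  simp only [AlgHom.toLinearMap_apply]
  erw [map_sub, map_mul, h]
  simp

end Pfaffian

open ExteriorAlgebra in
/-- The square of the Pfaffian of an alternating Gram matrix is its determinant. -/
theorem pfaffianForm_ιMulti_sq {K M : Type*} [Field K] [AddCommGroup M] [Module K M]
    (B : LinearMap.BilinForm K M) (hB : B.IsAlt) {n : ℕ} (v : Fin n → M) :
    pfaffianForm B hB (ιMulti K n v) ^ 2 = (Matrix.of fun i j => B (v i) (v j)).det := by
  induction n using Nat.strong_induction_on with
  | _ n ih =>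
  rcases n with _ | n
  · simp
  by_cases h0 : ∀ i, B (v 0) (v i) = 0
  · rw [Matrix.det_eq_zero_of_row_eq_zero 0 (by simpa using h0), ιMulti_succ_apply,
      pfaffianForm_ι_mul, interior_ιMulti_eq_zero _ (Matrix.vecTail v) fun i => h0 i.succ]
    simp
  push Not at h0
  obtain ⟨i, hi⟩ := h0
  rcases n with _ | n
  · rw [Fin.fin_one_eq_zero i] at hi
    exact absurd (hB _) hi
  have hi0 : i ≠ 0 := by rintro rfl; exact hi (hB _)
  -- swap so that the first two vectors pair nontrivially
  wlog h1 : i = 1 generalizing v i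
  · have := this (v ∘ Equiv.swap i 1) 1
      (by simpa [Equiv.swap_apply_of_ne_of_ne hi0.symm (by simp : (0 : Fin (n + 2)) ≠ 1)] using hi)
      (by simp) rfl
    rw [AlternatingMap.map_swap _ _ h1, map_neg, neg_sq] at this
    rw [this]
    exact Matrix.det_submatrix_equiv_self (Equiv.swap i 1) (Matrix.of fun i j => B (v i) (v j))
  subst h1
  set a := v 0
  set b := v 1
  set p := B a b with hp
  have hba : B b a = -p := by rw [hp, hB.neg_eq]
  set r : Fin n → M := fun i => v i.succ.succ with hr
  -- The coefficients make `r i + α i • a + β i • b` orthogonal to both `a` and `b`.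
  set α : Fin n → K := fun i => p⁻¹ * B b (r i) with hα
  set β : Fin n → K := fun i => -(p⁻¹ * B a (r i)) with hβ
  have hv : v = Matrix.vecCons a (Matrix.vecCons b r) := by
    funext j
    refine Fin.cases rfl (fun j => Fin.cases rfl (fun j => rfl) j) j
  have hpf : pfaffianForm B hB (ιMulti K (n + 2) v) =
      p * pfaffianForm B hB (ιMulti K n fun i => r i + α i • a + β i • b) := by
    rw [hv, ιMulti_succ_apply, ιMulti_succ_apply]
    simp only [Matrix.cons_val_zero, Matrix.tail_cons]
    -- After the correction, contraction with `B a` sees only `b`, and the factor `p` splits off.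
    rw [← ι_mul_ι_mul_ιMulti_add a b r α β, pfaffianForm_ι_mul, interior_ι_mul,
      interior_ιMulti_eq_zero]
    · simp [hp]
    · intro i
      simp [hB a, hβ, ← hp]
      field_simp
      ring
  rw [hpf, mul_pow, ih n (by omega)]
  have hdet : (Matrix.of fun i j => B (v i) (v j)).det =
      (Matrix.fromBlocks !![0, p; -p, 0]
        (Matrix.of fun (i : Fin 2) (j : Fin n) => B (![a, b] i) (r j))
        (Matrix.of fun (i : Fin n) (j : Fin 2) => B (r i) (![a, b] j))
        (Matrix.of fun i j => B (r i) (r j))).det := by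
    let e : Fin 2 ⊕ Fin n ≃ Fin (n + 2) := finSumFinEquiv.trans (finCongr (add_comm 2 n))
    have he : ∀ i, e (Sum.inr i) = i.succ.succ := fun i => by
      ext; simp [e]
    have he0 : e (Sum.inl 0) = 0 := rfl
    have he1 : e (Sum.inl 1) = 1 := rfl
    have hba' : B (v 1) (v 0) = -B (v 0) (v 1) := hba
    rw [← Matrix.det_submatrix_equiv_self e]
    congr 1
    ext i j
    rcases i with i | i <;> rcases j with j | j
    · fin_cases i <;> fin_cases j <;> simp [he0, he1, hB _, hp, hba', a, b]
    · fin_cases i <;> simp [he, he0, he1, a, b, r]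
    · fin_cases j <;> simp [he, he0, he1, a, b, r]
    · simp [he, r]
  let _ : Invertible !![0, p; -p, 0] := by
    refine ⟨!![0, -p⁻¹; p⁻¹, 0], ?_, ?_⟩ <;>
    · ext i j
      fin_cases i <;> fin_cases j <;> simp [hi]
  -- The 2×2 block contributes p²; its Schur complement is the Gram matrix of the corrected vectors.
  rw [hdet, Matrix.det_fromBlocks₁₁]
  congr 1
  · simp [Matrix.det_fin_two, sq]
  congr 1
  ext i j
  have hinv : ⅟!![0, p; -p, 0] = !![0, -p⁻¹; p⁻¹, 0] := rfl
  have h1 : B a (r i + α i • a + β i • b) = 0 := by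
    simp [hB a, hβ, ← hp]
    field_simp
    ring
  have h2 : B b (r i + α i • a + β i • b) = 0 := by
    simp [hB b, hα, hba]
    field_simp
    ring
  -- The left vector is orthogonal to `a` and `b`, so only one of the two corrections survives,
  -- which is the form the Schur complement takes.
  have h3 : B (r i + α i • a + β i • b) (r j + α j • a + β j • b) =
      B (r i + α i • a + β i • b) (r j) := by
    rw [map_add, map_add, map_smul, map_smul, ← hB.neg_eq a, ← hB.neg_eq b, h1, h2]
    simp
  have h4 : B (r i) a = -B a (r i) := (hB.neg_eq _ _).symm
  have h5 : B (r i) b = -B b (r i) := (hB.neg_eq _ _).symm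
  simp only [Matrix.of_apply, h3]
  simp [hinv, Matrix.mul_apply, Fin.sum_univ_two, hα, hβ, h4, h5]
  ring

/-! ### Wedge products of half-edges, and one step of the expansion. -/

section EdgePfaffian

open ExteriorAlgebra

variable {R M E : Type*} [CommRing R] [AddCommGroup M] [Module R M]

/-- The product `x_e ∧ x_{e⁻¹}` of the two half-edges of an edge. -/
noncomputable def edgeWedge (R : Type*) [CommRing R] [Module R M] (x : DirEdge E → M) (e : E) :
    ExteriorAlgebra R M :=
  ι R (x (e, true)) * ι R (x (e, false))

theorem edgeWedge_commute_ι (x : DirEdge E → M) (e : E) (m : M) :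
    Commute (edgeWedge R x e) (ι R m) := by
  rw [commute_iff_eq, edgeWedge, mul_assoc, ι_mul_ι_swap _ m, mul_neg, ι_mul_ι_mul_swap, neg_neg]

theorem edgeWedge_commute (x : DirEdge E → M) (e f : E) :
    Commute (edgeWedge R x e) (edgeWedge R x f) :=
  (edgeWedge_commute_ι x e _).mul_right (edgeWedge_commute_ι x e _)

/-- The product of the `x_e ∧ x_{e⁻¹}` over a set of edges. -/
noncomputable def edgesWedge (R : Type*) [CommRing R] [Module R M] (x : DirEdge E → M)
    (S : Finset E) : ExteriorAlgebra R M :=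
  S.noncommProd (edgeWedge R x) fun _ _ _ _ _ => edgeWedge_commute x _ _

theorem edgesWedge_empty (x : DirEdge E → M) : edgesWedge R x ∅ = 1 :=
  Finset.noncommProd_empty _ _

variable [DecidableEq E]

theorem edgesWedge_insert (x : DirEdge E → M) {e : E} {S : Finset E} (he : e ∉ S) :
    edgesWedge R x (insert e S) = edgeWedge R x e * edgesWedge R x S :=
  Finset.noncommProd_insert_of_notMem _ _ _ _ he

/-- Contraction is an antiderivation, and the factors have even degree and commute with vectors, so
the Leibniz rule carries no signs between edges. -/
theorem interior_edgesWedge (x : DirEdge E → M) (d : Module.Dual R M) (S : Finset E) :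
    interior d (edgesWedge R x S) = ∑ f ∈ S,
      (d (x (f, true)) • ι R (x (f, false)) - d (x (f, false)) • ι R (x (f, true))) *
        edgesWedge R x (S.erase f) := by
  induction S using Finset.induction_on with
  | empty => simp [edgesWedge_empty, interior_one]
  | insert e S he ih =>
    rw [Finset.sum_insert he, edgesWedge_insert x he, Finset.erase_insert he]
    have h1 : interior d (edgeWedge R x e * edgesWedge R x S) =
        (d (x (e, true)) • ι R (x (e, false)) - d (x (e, false)) • ι R (x (e, true))) *
          edgesWedge R x S + edgeWedge R x e * interior d (edgesWedge R x S) := by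
      rw [edgeWedge, mul_assoc, interior_ι_mul, interior_ι_mul, sub_mul, mul_sub, mul_assoc,
        smul_mul_assoc, smul_mul_assoc, mul_smul_comm]
      abel
    rw [h1, ih, Finset.mul_sum]
    congr 1
    refine Finset.sum_congr rfl fun f hf => ?_
    have hfe : f ≠ e := by rintro rfl; exact he hf
    rw [Finset.erase_insert_of_ne hfe.symm, edgesWedge_insert x (by simp [he]), ← mul_assoc,
      ← mul_assoc]
    congr 1
    exact ((edgeWedge_commute_ι x e _).smul_right _).sub_right
      ((edgeWedge_commute_ι x e _).smul_right _)

variable (B : LinearMap.BilinForm R M) (hB : B.IsAlt) (x : DirEdge E → M)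

/-- The two free half-edges are the ends of an open path that starts with `a` and ends with `c`. The
end `c.inv` is paired with `a`, closing the path, or with one half of an unused edge `f`, whose
other half becomes the new end. -/
theorem pfaffianForm_open_path (a c : DirEdge E) (S : Finset E) :
    pfaffianForm B hB (ι R (x c.inv) * (ι R (x a) * edgesWedge R x S)) =
      B (x c.inv) (x a) * pfaffianForm B hB (edgesWedge R x S) + ∑ f ∈ S,
        (B (x c.inv) (x (f, true)) * pfaffianForm B hB
            (ι R (x (DirEdge.inv (f, true))) * (ι R (x a) * edgesWedge R x (S.erase f))) -
          B (x c.inv) (x (f, false)) * pfaffianForm B hB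
            (ι R (x (DirEdge.inv (f, false))) * (ι R (x a) * edgesWedge R x (S.erase f)))) := by
  rw [pfaffianForm_ι_mul, interior_ι_mul, interior_edgesWedge, map_sub, map_smul, smul_eq_mul,
    sub_eq_add_neg, Finset.mul_sum, map_sum, ← Finset.sum_neg_distrib]
  congr 1
  refine Finset.sum_congr rfl fun f _ => ?_
  simp only [DirEdge.inv, Bool.not_true, Bool.not_false]
  rw [sub_mul, smul_mul_assoc, smul_mul_assoc, mul_sub, mul_smul_comm, mul_smul_comm,
    ι_mul_ι_mul_swap (x a), ι_mul_ι_mul_swap (x a)]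
  simp
  ring

theorem pfaffianForm_edgesWedge_insert {e : E} {S : Finset E} (he : e ∉ S) :
    pfaffianForm B hB (edgesWedge R x (insert e S)) =
      -pfaffianForm B hB (ι R (x (DirEdge.inv (e, true))) *
        (ι R (x (e, true)) * edgesWedge R x S)) := by
  rw [edgesWedge_insert x he, edgeWedge, mul_assoc, ι_mul_ι_mul_swap, map_neg]
  rfl

end EdgePfaffian

/-! ### Edge-simple paths and their weights. -/

section PathLists

variable {E : Type*}

/-- Sequences of directed edges that use each edge at most once, and only edges in `S`. -/
noncomputable def pathLists [Fintype E] [DecidableEq E] (S : Finset E) : Finset (List (DirEdge E)) :=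
  Set.Finite.toFinset (s := {m | (m.map Prod.fst).Nodup ∧ ∀ g ∈ m, g.1 ∈ S}) <| by
    have : Finite {m : List (DirEdge E) | m.Nodup} :=
      inferInstanceAs (Finite {m : List (DirEdge E) // m.Nodup})
    refine Set.Finite.subset (Set.toFinite {m : List (DirEdge E) | m.Nodup}) ?_
    exact fun m hm => hm.1.of_map

theorem mem_pathLists [Fintype E] [DecidableEq E] {S : Finset E} {m : List (DirEdge E)} :
    m ∈ pathLists S ↔ (m.map Prod.fst).Nodup ∧ ∀ g ∈ m, g.1 ∈ S := by
  simp [pathLists]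

theorem sum_pathLists [Fintype E] [DecidableEq E] {A : Type*} [AddCommMonoid A] (S : Finset E) (F : List (DirEdge E) → A) :
    ∑ m ∈ pathLists S, F m = F [] + ∑ f ∈ S,
      (∑ m ∈ pathLists (S.erase f), F ((f, true) :: m) +
        ∑ m ∈ pathLists (S.erase f), F ((f, false) :: m)) := by
  have h : pathLists S = insert [] (((S ×ˢ (Finset.univ : Finset Bool)).sigma
      fun g => pathLists (S.erase g.1)).image fun p => p.1 :: p.2) := by
    ext m
    cases m with
    | nil => simp [mem_pathLists]
    | cons g m =>
      simp only [mem_pathLists, List.map_cons, List.nodup_cons, List.mem_cons, List.mem_map,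
        Finset.mem_insert, reduceCtorEq, Finset.mem_image, Finset.mem_sigma, Finset.mem_product,
        Finset.mem_univ, and_true, Finset.mem_erase, false_or, Sigma.exists, List.cons.injEq]
      constructor
      · rintro ⟨⟨h1, h2⟩, h3⟩
        exact ⟨g, m, ⟨h3 g (.inl rfl), h2, fun g' hg' =>
          ⟨fun h => h1 ⟨g', hg', h⟩, h3 g' (.inr hg')⟩⟩, rfl, rfl⟩
      · rintro ⟨g, m, ⟨h1, h2, h3⟩, rfl, rfl⟩
        refine ⟨⟨?_, h2⟩, ?_⟩
        · rintro ⟨g', hg', h⟩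
          exact (h3 g' hg').1 h
        · rintro g' (rfl | hg')
          · exact h1
          · exact (h3 g' hg').2
  rw [h, Finset.sum_insert (by simp), Finset.sum_image (by
    rintro ⟨g, m⟩ _ ⟨g', m'⟩ _ h
    simpa using h), Finset.sum_sigma, Finset.sum_product]
  simp

/-- The product of the weights `T (e₁⁻¹, e₂) ⋯ T (eₙ⁻¹, a)` along the path `c = e₁, …, eₙ`
closed by `a`, where `e₂, …, eₙ` is the given list. -/
def pathWeight {R : Type*} [Mul R] (T : DirEdge E → DirEdge E → R) (a : DirEdge E) :
    DirEdge E → List (DirEdge E) → R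
  | c, [] => T c.inv a
  | c, g :: m => T c.inv g * pathWeight T a g m

end PathLists

/-! ### The Pfaffian as a sum over closed paths through an edge. -/

section PathExpansion

open ExteriorAlgebra

variable {R M E : Type*} [CommRing R] [AddCommGroup M] [Module R M] [Fintype E] [DecidableEq E]
  (B : LinearMap.BilinForm R M) (hB : B.IsAlt) (x : DirEdge E → M) (T : DirEdge E → DirEdge E → R)

/-- Iterates `pfaffianForm_open_path` until the path closes. The coefficient `B + T` vanishes unless
`c` and `a` lie on the same edge; keeping it lets one induction cover both the initial position `c =
a` and the later ones. -/
theorem pfaffianForm_open_path_eq_sum (hT : ∀ a b : DirEdge E, a.1 ≠ b.1 → B (x a) (x b) = -T a b)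
    (a : DirEdge E) (S : Finset E) (ha : a.1 ∉ S) (c : DirEdge E) (hc : c.1 ∉ S) :
    pfaffianForm B hB (ι R (x c.inv) * (ι R (x a) * edgesWedge R x S)) =
      (B (x c.inv) (x a) + T c.inv a) * pfaffianForm B hB (edgesWedge R x S) -
        ∑ m ∈ pathLists S, (-1) ^ (m.countP fun g => g.2) * pathWeight T a c m *
          pfaffianForm B hB (edgesWedge R x (S \ (m.map Prod.fst).toFinset)) := by
  induction S using Finset.strongInduction generalizing c with
  | H S ih =>
  have key : ∀ f ∈ S, ∀ b : Bool, pfaffianForm B hB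
      (ι R (x (DirEdge.inv (f, b))) * (ι R (x a) * edgesWedge R x (S.erase f))) =
      -∑ m ∈ pathLists (S.erase f), (-1) ^ (m.countP fun g => g.2) * pathWeight T a (f, b) m *
          pfaffianForm B hB (edgesWedge R x (S \ (((f, b) :: m).map Prod.fst).toFinset)) := by
    intro f hf b
    -- Past the first step the end lies on an edge other than that of `a`, so the correction term is
    -- zero.
    have hfa : f ≠ a.1 := by rintro rfl; exact ha hf
    rw [ih _ (Finset.erase_ssubset hf) (by simp [ha]) (f, b) (by simp), hT _ _ hfa]
    simp only [neg_add_cancel, zero_mul, zero_sub, List.map_cons, List.toFinset_cons]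
    simp only [Finset.sdiff_insert, Finset.erase_sdiff_comm]
  rw [pfaffianForm_open_path, sum_pathLists, add_mul]
  simp only [List.countP_nil, pow_zero, one_mul, List.map_nil, List.toFinset_nil,
    Finset.sdiff_empty]
  -- The empty path cancels the `T` added in the coefficient.
  rw [← sub_sub, show pathWeight T a c [] = T c.inv a from rfl, add_sub_cancel_right,
    sub_eq_add_neg, ← Finset.sum_neg_distrib]
  congr 1
  refine Finset.sum_congr rfl fun f hf => ?_
  have hfc : c.inv.1 ≠ f := by rintro rfl; exact hc hf
  rw [key f hf, key f hf, hT _ (f, true) hfc, hT _ (f, false) hfc]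
  simp only [pathWeight, List.countP_cons, if_true, Bool.false_eq_true, if_false, add_zero,
    pow_succ, mul_neg, neg_mul, neg_neg, mul_one, Finset.sum_neg_distrib, neg_add,
    Finset.mul_sum]
  rw [sub_eq_add_neg]
  congr 1
  · exact Finset.sum_congr rfl fun m _ => by ring
  · congr 1
    exact Finset.sum_congr rfl fun m _ => by ring

/-- The case `c = a = (e, true)`: there `B + T` equals -1, which accounts for the term in which `e`
is unused. -/
theorem pfaffianForm_edgesWedge_insert_eq_sum
    (hT : ∀ a b : DirEdge E, a.1 ≠ b.1 → B (x a) (x b) = -T a b)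
    (hl : ∀ e : E, B (x (e, false)) (x (e, true)) = -1 - T (e, false) (e, true))
    {e : E} {S : Finset E} (he : e ∉ S) :
    pfaffianForm B hB (edgesWedge R x (insert e S)) = pfaffianForm B hB (edgesWedge R x S) +
        ∑ m ∈ pathLists S, (-1) ^ (m.countP fun g => g.2) * pathWeight T (e, true) (e, true) m *
          pfaffianForm B hB (edgesWedge R x (S \ (m.map Prod.fst).toFinset)) := by
  rw [pfaffianForm_edgesWedge_insert _ _ _ he,
    pfaffianForm_open_path_eq_sum B hB x T hT (e, true) S he (e, true) he]
  simp only [DirEdge.inv, Bool.not_true]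
  rw [hl]
  ring

end PathExpansion

/-! ### Recursion for sums over disjoint collections. -/

section Collections

variable {Λ E R : Type*} [Fintype Λ] [DecidableEq Λ] [DecidableEq E] [CommRing R]

open Classical in
/-- The sum over all sets of loops with pairwise disjoint supports contained in `S`. -/
noncomputable def collectionSum (supp : Λ → Finset E) (A : Λ → R) (S : Finset E) : R :=
  ∑ L : Finset Λ with (∀ ℓ ∈ L, supp ℓ ⊆ S) ∧
    ∀ ℓ ∈ L, ∀ ℓ' ∈ L, ℓ ≠ ℓ' → Disjoint (supp ℓ) (supp ℓ'), ∏ ℓ ∈ L, A ℓ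

/-- By disjointness at most one member of a collection covers `e`. Removing it leaves a collection
supported away from it. -/
theorem collectionSum_insert (supp : Λ → Finset E) (A : Λ → R) {e : E} {S : Finset E}
    (he : e ∉ S) :
    collectionSum supp A (insert e S) = collectionSum supp A S +
      ∑ ℓ with e ∈ supp ℓ ∧ supp ℓ ⊆ insert e S,
        A ℓ * collectionSum supp A (insert e S \ supp ℓ) := by
  classical
  simp only [collectionSum]
  rw [← Finset.sum_filter_not_add_sum_filter _ fun L => ∃ ℓ ∈ L, e ∈ supp ℓ]
  congr 1
  · refine Finset.sum_congr ?_ fun _ _ => rfl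
    ext L
    simp only [Finset.mem_filter, Finset.mem_univ, true_and, not_exists, not_and]
    constructor
    · rintro ⟨⟨h1, h2⟩, h3⟩
      exact ⟨fun ℓ hℓ => (Finset.subset_insert_iff_of_notMem (h3 ℓ hℓ)).1 (h1 ℓ hℓ), h2⟩
    · rintro ⟨h1, h2⟩
      exact ⟨⟨fun ℓ hℓ => (h1 ℓ hℓ).trans (Finset.subset_insert _ _), h2⟩,
        fun ℓ hℓ h => he (h1 ℓ hℓ h)⟩
  · simp only [Finset.mul_sum]
    rw [Finset.sum_sigma']
    symm
    -- The loop through `e` can be recovered from the enlarged collection, since no other member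
    -- contains `e`.
    have hmem : ∀ p : (_ : Λ) × Finset Λ, e ∈ supp p.1 →
        (∀ ℓ ∈ p.2, supp ℓ ⊆ insert e S \ supp p.1) → p.1 ∉ p.2 ∧ ∀ ℓ ∈ p.2, e ∉ supp ℓ := by
      intro p h1 h2
      refine ⟨fun h => (Finset.mem_sdiff.1 (h2 _ h h1)).2 h1,
        fun ℓ hℓ h => (Finset.mem_sdiff.1 (h2 _ hℓ h)).2 h1⟩
    refine Finset.sum_bij (fun p _ => insert p.1 p.2) ?_ ?_ ?_ ?_
    · rintro ⟨ℓ, L⟩ h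
      simp only [Finset.mem_sigma, Finset.mem_filter, Finset.mem_univ, true_and] at h ⊢
      obtain ⟨⟨h1, h2⟩, h3, h4⟩ := h
      have hd : ∀ ℓ' ∈ L, Disjoint (supp ℓ) (supp ℓ') := fun ℓ' hℓ' =>
        (Finset.disjoint_sdiff).mono_right (h3 ℓ' hℓ')
      refine ⟨⟨?_, ?_⟩, ℓ, by simp, h1⟩
      · intro ℓ' hℓ'
        rcases Finset.mem_insert.1 hℓ' with rfl | hℓ'
        · exact h2
        · exact (h3 ℓ' hℓ').trans Finset.sdiff_subset
      · intro ℓ₁ h₁ ℓ₂ h₂ hne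
        rcases Finset.mem_insert.1 h₁ with rfl | h₃ <;> rcases Finset.mem_insert.1 h₂ with rfl | h₄
        · exact absurd rfl hne
        · exact hd _ h₄
        · exact (hd _ h₃).symm
        · exact h4 _ h₃ _ h₄ hne
    · rintro ⟨ℓ, L⟩ h ⟨ℓ', L'⟩ h' heq
      simp only [Finset.mem_sigma, Finset.mem_filter, Finset.mem_univ, true_and] at h h'
      change insert ℓ L = insert ℓ' L' at heq
      obtain ⟨m1, m2⟩ := hmem ⟨ℓ, L⟩ h.1.1 h.2.1
      obtain ⟨m1', m2'⟩ := hmem ⟨ℓ', L'⟩ h'.1.1 h'.2.1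
      have hℓ : ℓ = ℓ' := by
        have : ℓ ∈ insert ℓ' L' := by
          have := Finset.mem_insert_self ℓ L
          rwa [heq] at this
        rcases Finset.mem_insert.1 this with h0 | h0
        · exact h0
        · exact absurd h.1.1 (m2' _ h0)
      subst hℓ
      have : L = L' := by
        rw [← Finset.erase_insert (s := L) m1, heq, Finset.erase_insert (s := L') m1']
      rw [this]
    · intro L hL
      simp only [Finset.mem_filter, Finset.mem_univ, true_and] at hL
      obtain ⟨⟨h1, h2⟩, ℓ, hℓ, h3⟩ := hL
      refine ⟨⟨ℓ, L.erase ℓ⟩, ?_, Finset.insert_erase hℓ⟩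
      simp only [Finset.mem_sigma, Finset.mem_filter, Finset.mem_univ, true_and]
      refine ⟨⟨h3, h1 ℓ hℓ⟩, fun ℓ' hℓ' => ?_, fun ℓ₁ h₁ ℓ₂ h₂ hne =>
        h2 _ (Finset.mem_of_mem_erase h₁) _ (Finset.mem_of_mem_erase h₂) hne⟩
      have hℓ2 := Finset.mem_erase.1 hℓ'
      exact Finset.subset_sdiff.2 ⟨h1 _ hℓ2.2, h2 _ hℓ2.2 _ hℓ hℓ2.1⟩
    · rintro ⟨ℓ, L⟩ h
      simp only [Finset.mem_sigma, Finset.mem_filter, Finset.mem_univ, true_and] at h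
      exact (Finset.prod_insert (hmem ⟨ℓ, L⟩ h.1.1 h.2.1).1).symm

end Collections

/-! ### Simple loops through an edge as paths based at that edge. -/

namespace OrientedGraph

variable {V E : Type*} {Γ : OrientedGraph V E}

open Classical in
/-- The weights of all vertices as one matrix indexed by the directed edges. -/
noncomputable def Weights.matrix (τ : Γ.Weights) (a b : DirEdge E) : ℂ :=
  if Γ.s a = Γ.s b then τ.val (Γ.s a) a b else 0

theorem Weights.matrix_swap (τ : Γ.Weights) (a b : DirEdge E) :
    τ.matrix a b = -τ.matrix b a := by
  unfold Weights.matrix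
  by_cases h : Γ.s a = Γ.s b
  · rw [if_pos h, if_pos h.symm, ← h]
    exact τ.antisymm _ _ _ rfl h.symm
  · rw [if_neg h, if_neg (Ne.symm h), neg_zero]

/-- The matrix vanishes between half-edges at different vertices, so sequences that are not paths in
the graph drop out of the Pfaffian. -/
theorem isChain_of_pathWeight_ne_zero (τ : Γ.Weights) (a c : DirEdge E) (m : List (DirEdge E))
    (h : pathWeight τ.matrix a c m ≠ 0) :
    List.IsChain (fun a b => Γ.t a = Γ.s b) (c :: (m ++ [a])) := by
  have hT : ∀ a b : DirEdge E, τ.matrix a.inv b ≠ 0 → Γ.t a = Γ.s b := by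
    intro a b h
    by_contra h'
    exact h (by simp [Weights.matrix, h'])
  induction m generalizing c with
  | nil => simpa using hT c a h
  | cons g m ih =>
    rw [List.cons_append, List.isChain_cons_cons]
    exact ⟨hT c g (left_ne_zero_of_mul h), ih g (right_ne_zero_of_mul h)⟩

theorem prod_zipWith_eq_pathWeight (τ : Γ.Weights) (a c : DirEdge E) (m : List (DirEdge E))
    (h : List.IsChain (fun a b => Γ.t a = Γ.s b) (c :: (m ++ [a]))) :
    (List.zipWith (fun a b => τ.val (Γ.s b) a.inv b) (c :: m) (m ++ [a])).prod =
      pathWeight τ.matrix a c m := by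
  have hT : ∀ a b : DirEdge E, Γ.t a = Γ.s b → τ.matrix a.inv b = τ.val (Γ.s b) a.inv b := by
    intro a b h
    simp [Weights.matrix, h]
  induction m generalizing c with
  | nil => simp at h; simp [pathWeight, hT c a h]
  | cons g m ih =>
    rw [List.cons_append, List.isChain_cons_cons] at h
    rw [List.cons_append, List.zipWith_cons_cons, List.prod_cons, ih g h.2, pathWeight, hT c g h.1]

/-- The initial edge agrees with the orientation, and its sign cancels the overall minus of the
amplitude. -/
theorem cycleAmplitude_cons (τ : Γ.Weights) (e : E) (m : List (DirEdge E))
    (h : ((((e, true) :: m : List (DirEdge E)) : Cycle (DirEdge E))).Chain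
      fun a b => Γ.t a = Γ.s b) :
    cycleAmplitude τ (((e, true) :: m : List (DirEdge E)) : Cycle (DirEdge E)) =
      (-1) ^ (m.countP fun g => g.2) * pathWeight τ.matrix (e, true) (e, true) m := by
  rw [Cycle.chain_coe_cons] at h
  change listAmplitude τ _ = _
  rw [listAmplitude, List.rotate_cons_succ, List.rotate_zero, prod_zipWith_eq_pathWeight τ _ _ _ h]
  simp [pow_succ]

/-- The simple loop given by a closed sequence of directed edges. -/
def SimpleLoop.mk (l : List (DirEdge E)) (h : Γ.IsSimpleLoop (l : Cycle (DirEdge E))) :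
    Γ.SimpleLoop :=
  Quotient.mk Γ.loopSetoid ⟨(l : Cycle (DirEdge E)), h⟩

theorem SimpleLoop.mem_edges_mk {l : List (DirEdge E)}
    (h : Γ.IsSimpleLoop (l : Cycle (DirEdge E))) (e : E) :
    e ∈ (SimpleLoop.mk l h).edges ↔ e ∈ l.map Prod.fst := Iff.rfl

/-- The edges used by a simple loop, as a finset. -/
noncomputable def SimpleLoop.support [Fintype E] (ℓ : Γ.SimpleLoop) : Finset E :=
  (Set.toFinite ℓ.edges).toFinset

theorem SimpleLoop.mem_support [Fintype E] {ℓ : Γ.SimpleLoop} {e : E} : e ∈ ℓ.support ↔ e ∈ ℓ.edges := by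
  simp [SimpleLoop.support]

theorem SimpleLoop.support_mk [Fintype E] [DecidableEq E] (l : List (DirEdge E))
    (h : Γ.IsSimpleLoop (l : Cycle (DirEdge E))) :
    (SimpleLoop.mk l h).support = (l.map Prod.fst).toFinset := by
  ext e
  rw [SimpleLoop.mem_support, List.mem_toFinset, SimpleLoop.mem_edges_mk]

theorem isSimpleLoop_coe_cons {e : E} {m : List (DirEdge E)} :
    Γ.IsSimpleLoop (((e, true) :: m : List (DirEdge E)) : Cycle (DirEdge E)) ↔
      List.IsChain (fun a b => Γ.t a = Γ.s b) ((e, true) :: (m ++ [(e, true)])) ∧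
        e ∉ m.map Prod.fst ∧ (m.map Prod.fst).Nodup := by
  rw [IsSimpleLoop, Cycle.chain_coe_cons]
  have : (((e, true) :: m : List (DirEdge E)) : Cycle (DirEdge E)) ≠ Cycle.nil := by
    simp [← Cycle.coe_nil, -Cycle.coe_eq_coe]
    rw [Cycle.coe_eq_coe]
    simp
  rw [Cycle.map_coe, Cycle.nodup_coe_iff, List.map_cons, List.nodup_cons]
  simp only [this, ne_eq, not_false_eq_true, true_and]

theorem _root_.List.Nodup.eq_of_cons_isRotated_cons {α : Type*} {a : α} {m m' : List α}
    (hnd : (a :: m).Nodup) (h : (a :: m) ~r (a :: m')) : m = m' := by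
  obtain ⟨k, hk⟩ := h
  rw [← List.rotate_mod] at hk
  have hlt : k % (a :: m).length < (a :: m).length := Nat.mod_lt _ (by simp)
  have h1 := congrArg List.head? hk
  rw [List.head?_rotate hlt, List.getElem?_eq_getElem hlt, List.head?_cons, Option.some_inj] at h1
  have h2 : (a :: m)[k % (a :: m).length] = (a :: m)[0] := h1
  rw [hnd.getElem_inj_iff] at h2
  rw [h2, List.rotate_zero] at hk
  exact (List.cons.inj hk).2

/-- Two simple loops through `e`, written as starting from `e`, agree only if they agree as
lists. -/
theorem eq_of_loopSetoid_cons {e : E} {m m' : List (DirEdge E)}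
    (h : Γ.IsSimpleLoop (((e, true) :: m : List (DirEdge E)) : Cycle (DirEdge E)))
    (h' : Γ.IsSimpleLoop (((e, true) :: m' : List (DirEdge E)) : Cycle (DirEdge E)))
    (heq : (((e, true) :: m' : List (DirEdge E)) : Cycle (DirEdge E)) =
        (((e, true) :: m : List (DirEdge E)) : Cycle (DirEdge E)) ∨
      (((e, true) :: m' : List (DirEdge E)) : Cycle (DirEdge E)) =
        revCycle (((e, true) :: m : List (DirEdge E)) : Cycle (DirEdge E))) : m = m' := by
  obtain ⟨-, hm, hnd⟩ := isSimpleLoop_coe_cons.1 h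
  obtain ⟨-, hm', hnd'⟩ := isSimpleLoop_coe_cons.1 h'
  rcases heq with heq | heq
  · rw [Cycle.coe_eq_coe] at heq
    refine List.Nodup.eq_of_cons_isRotated_cons (List.Nodup.of_map Prod.fst ?_) heq.symm
    rw [List.map_cons, List.nodup_cons]
    exact ⟨hm, hnd⟩
  -- The reversed loop contains `(e, false)`. Containing `(e, true)` as well would mean that `e` is
  -- used twice.
  · exfalso
    rw [revCycle_coe, Cycle.coe_eq_coe] at heq
    have h1 : (e, true) ∈ ((((e, true) :: m).map DirEdge.inv).reverse) :=
      heq.mem_iff.1 (by simp)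
    rw [List.mem_reverse, List.mem_map] at h1
    obtain ⟨g, hg, hge⟩ := h1
    rcases List.mem_cons.1 hg with rfl | hg
    · simp [DirEdge.inv] at hge
    · exact hm (List.mem_map.2 ⟨g, hg, by rw [← DirEdge.inv_fst, hge]⟩)

theorem coe_eq_coe_cons_of_mem {α : Type*} {a : α} {l : List α} (h : a ∈ l) :
    ∃ m : List α, (l : Cycle α) = ((a :: m : List α) : Cycle α) := by
  obtain ⟨l₁, l₂, rfl⟩ := List.append_of_mem h
  exact ⟨l₂ ++ l₁, Cycle.coe_eq_coe.2 List.isRotated_append⟩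

theorem isSimpleLoop_revCycle {e : E} {m : List (DirEdge E)}
    (h : Γ.IsSimpleLoop (((e, false) :: m : List (DirEdge E)) : Cycle (DirEdge E))) :
    Γ.IsSimpleLoop (((e, true) :: (m.map DirEdge.inv).reverse : List (DirEdge E)) :
      Cycle (DirEdge E)) := by
  obtain ⟨-, h1, h2⟩ := h
  rw [Cycle.chain_coe_cons] at h1
  rw [Cycle.map_coe, Cycle.nodup_coe_iff, List.map_cons, List.nodup_cons] at h2
  rw [isSimpleLoop_coe_cons]
  refine ⟨?_, ?_, ?_⟩
  · have : (e, true) :: ((m.map DirEdge.inv).reverse ++ [(e, true)]) =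
        (((e, false) :: (m ++ [(e, false)])).map DirEdge.inv).reverse := by
      simp [DirEdge.inv]
    rw [this, List.isChain_reverse, List.isChain_map]
    refine h1.imp fun a b hab => ?_
    rw [t_inv, s_inv, hab]
  · simpa [Function.comp_def] using h2.1
  · rw [List.map_reverse, List.nodup_reverse, List.map_map]
    exact h2.2

/-- Every simple loop through `e` can be written as starting from `e`. -/
theorem SimpleLoop.exists_eq_cons (ℓ : Γ.SimpleLoop) {e : E} (he : e ∈ ℓ.edges) :
    ∃ (m : List (DirEdge E))
      (h : Γ.IsSimpleLoop (((e, true) :: m : List (DirEdge E)) : Cycle (DirEdge E))),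
      ℓ = SimpleLoop.mk _ h := by
  induction ℓ using Quotient.inductionOn with
  | h c =>
  obtain ⟨c, hc⟩ := c
  induction c using Quotient.inductionOn' with
  | h l =>
  rw [Cycle.mk''_eq_coe] at *
  have he' : e ∈ l.map Prod.fst := he
  obtain ⟨⟨e', b⟩, hg, rfl⟩ := List.mem_map.1 he'
  obtain ⟨m, hm⟩ := coe_eq_coe_cons_of_mem hg
  have hc' := hm ▸ hc
  cases b with
  | true => exact ⟨m, hc', Quotient.sound (Or.inl hm.symm)⟩
  -- A loop traversing `e` backwards is replaced by its reversal, which is the same simple loop.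
  | false =>
    refine ⟨_, isSimpleLoop_revCycle hc', Quotient.sound (Or.inr ?_)⟩
    change _ = revCycle (l : Cycle (DirEdge E))
    rw [hm, revCycle_coe, Cycle.coe_eq_coe, List.map_cons, List.reverse_cons]
    exact (List.isRotated_append (l := [(e', true)]))

/-- Starting at `(e, true)` fixes both the base point and the direction, so loops through `e`
correspond bijectively to the closed paths in the Pfaffian expansion; sequences that do not close up
have weight zero. -/
theorem sum_simpleLoop_eq_sum_pathLists [Fintype E] [DecidableEq E] (τ : Γ.Weights) {e : E} {S : Finset E} (he : e ∉ S)
    (F : Finset E → ℂ) :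
    ∑ ℓ : Γ.SimpleLoop with e ∈ ℓ.support ∧ ℓ.support ⊆ insert e S,
        ℓ.amplitude τ * F (insert e S \ ℓ.support) =
      ∑ m ∈ pathLists S, (-1) ^ (m.countP fun g => g.2) *
        pathWeight τ.matrix (e, true) (e, true) m * F (S \ (m.map Prod.fst).toFinset) := by
  classical
  rw [← Finset.sum_filter_of_ne (p := fun m : List (DirEdge E) =>
    Γ.IsSimpleLoop (((e, true) :: m : List (DirEdge E)) : Cycle (DirEdge E)))]
  · symm
    have hset : ∀ m ∈ pathLists S, insert e S \ (((e, true) :: m).map Prod.fst).toFinset =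
        S \ (m.map Prod.fst).toFinset := by
      intro m hm
      ext f
      have : f = e → f ∉ S := by rintro rfl; exact he
      simp only [List.map_cons, List.toFinset_cons, Finset.mem_sdiff, Finset.mem_insert]
      tauto
    refine Finset.sum_bij (fun m hm => SimpleLoop.mk _ (Finset.mem_filter.1 hm).2)
      ?_ ?_ ?_ ?_
    · intro m hm
      simp only [Finset.mem_filter, Finset.mem_univ, true_and]
      rw [SimpleLoop.support_mk]
      have h := mem_pathLists.1 (Finset.mem_filter.1 hm).1
      refine ⟨by simp, ?_⟩
      intro f hf
      rw [List.mem_toFinset, List.map_cons, List.mem_cons, List.mem_map] at hf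
      rcases hf with rfl | ⟨g, hg, rfl⟩
      · simp
      · exact Finset.mem_insert_of_mem (h.2 g hg)
    · intro m hm m' hm' heq
      exact eq_of_loopSetoid_cons (Finset.mem_filter.1 hm).2 (Finset.mem_filter.1 hm').2
        (Quotient.exact heq)
    · intro ℓ hℓ
      simp only [Finset.mem_filter, Finset.mem_univ, true_and] at hℓ
      obtain ⟨m, h, rfl⟩ := ℓ.exists_eq_cons (SimpleLoop.mem_support.1 hℓ.1)
      obtain ⟨-, h1, h2⟩ := isSimpleLoop_coe_cons.1 h
      refine ⟨m, Finset.mem_filter.2 ⟨mem_pathLists.2 ⟨h2, fun g hg => ?_⟩, h⟩, rfl⟩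
      have h3 := hℓ.2
      rw [SimpleLoop.support_mk] at h3
      have hgm : g.1 ∈ m.map Prod.fst := List.mem_map_of_mem hg
      refine (Finset.mem_insert.1 (h3 (List.mem_toFinset.2 (List.mem_cons_of_mem _ hgm)))).resolve_left
        ?_
      rintro h4
      exact h1 (h4 ▸ hgm)
    · intro m hm
      rw [SimpleLoop.support_mk, hset m (Finset.mem_filter.1 hm).1]
      congr 1
      exact (cycleAmplitude_cons τ e m (Finset.mem_filter.1 hm).2.2.1).symm
  · intro m hm hne
    rw [isSimpleLoop_coe_cons]
    have h := mem_pathLists.1 hm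
    refine ⟨isChain_of_pathWeight_ne_zero τ _ _ _
      (right_ne_zero_of_mul (left_ne_zero_of_mul hne)), ?_, h.1⟩
    intro h'
    obtain ⟨g, hg, rfl⟩ := List.mem_map.1 h'
    exact he (h.2 g hg)

end OrientedGraph

/-! ### The Pfaffian over all half-edges, and the reversal matrix. -/

section

open ExteriorAlgebra

variable {R M E : Type*} [CommRing R] [AddCommGroup M] [Module R M] [DecidableEq E]

theorem edgesWedge_toFinset (x : DirEdge E → M) {l : List E} (hl : l.Nodup) :
    edgesWedge R x l.toFinset =
      ((l.flatMap fun e => [(e, true), (e, false)]).map fun a => ι R (x a)).prod := by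
  induction l with
  | nil => simp [edgesWedge_empty]
  | cons e l ih =>
    rw [List.nodup_cons] at hl
    rw [List.toFinset_cons, edgesWedge_insert x (by simpa using hl.1), ih hl.2]
    simp [edgeWedge, mul_assoc]

theorem pfaffianForm_edgesWedge_univ_sq {K : Type*} [Field K] [Module K M] [Fintype E]
    (B : LinearMap.BilinForm K M) (hB : B.IsAlt) (x : DirEdge E → M) :
    pfaffianForm B hB (edgesWedge K x Finset.univ) ^ 2 =
      (Matrix.of fun a b => B (x a) (x b)).det := by
  -- List the half-edges with `e` and `e⁻¹` adjacent, so that the product over edges becomes one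
  -- wedge of vectors.
  set l : List (DirEdge E) := (Finset.univ : Finset E).toList.flatMap
    fun e => [(e, true), (e, false)] with hl
  have hnd : l.Nodup := by
    rw [hl, List.nodup_flatMap]
    refine ⟨fun e _ => by simp, ?_⟩
    refine (Finset.nodup_toList _).imp fun {a b} hab => ?_
    simp [Function.onFun, hab.symm]
  have hmem : ∀ a, a ∈ l := by
    rintro ⟨e, _ | _⟩ <;> simp [hl]
  have h1 : edgesWedge K x Finset.univ = ιMulti K l.length fun i => x (l.get i) := by
    have := edgesWedge_toFinset (R := K) x (Finset.nodup_toList (Finset.univ : Finset E))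
    rw [Finset.toList_toFinset] at this
    rw [this, ιMulti_apply, ← hl]
    congr 1
    exact (List.ofFn_getElem_eq_map l fun a => ι K (x a)).symm
  rw [h1, pfaffianForm_ιMulti_sq]
  exact Matrix.det_submatrix_equiv_self (hnd.getEquivOfForallMemList l hmem)
    (Matrix.of fun a b => B (x a) (x b))

end

/-- The skew matrix pairing each edge with its reversal. -/
def reversalMatrix (E : Type*) [DecidableEq E] : Matrix (DirEdge E) (DirEdge E) ℂ :=
  Matrix.of fun a b => if b = a.inv then (if a.2 then 1 else -1) else 0

theorem reversalMatrix_swap {E : Type*} [DecidableEq E] (a b : DirEdge E) :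
    reversalMatrix E a b = -reversalMatrix E b a := by
  rcases a with ⟨e, _ | _⟩ <;> rcases b with ⟨f, _ | _⟩ <;>
    simp [reversalMatrix, DirEdge.inv, eq_comm (a := e)] <;>
    split_ifs <;> simp

/-- The matrix is block diagonal, with one standard symplectic 2×2 block per edge. -/
theorem det_reversalMatrix (E : Type*) [Fintype E] [DecidableEq E] :
    (reversalMatrix E).det = 1 := by
  have : reversalMatrix E = Matrix.kroneckerMap (· * ·) (1 : Matrix E E ℂ)
      (Matrix.of fun a b : Bool => if a = b then 0 else if a then 1 else -1) := by
    ext ⟨e, a⟩ ⟨f, b⟩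
    cases a <;> cases b <;> simp [reversalMatrix, DirEdge.inv, Matrix.one_apply, eq_comm (a := e)] <;>
      split_ifs <;> simp
  have h2 : (Matrix.of fun a b : Bool => if a = b then (0 : ℂ) else if a then 1 else -1).det = 1 := by
    rw [← Matrix.det_submatrix_equiv_self finTwoEquiv, Matrix.det_fin_two]
    simp [finTwoEquiv]
  erw [this, Matrix.det_kronecker]
  rw [h2]
  simp

/-! ### The determinant is the square of the loop sum. -/

namespace OrientedGraph

variable {V E : Type*} {Γ : OrientedGraph V E} [Fintype E]

theorem SimpleLoop.support_nonempty (ℓ : Γ.SimpleLoop) : ℓ.support.Nonempty := by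
  induction ℓ using Quotient.inductionOn with
  | h c =>
  obtain ⟨c, hc⟩ := c
  induction c using Quotient.inductionOn' with
  | h l =>
  rw [Cycle.mk''_eq_coe] at *
  rcases l with _ | ⟨a, l⟩
  · exact absurd rfl hc.1
  · exact ⟨a.1, SimpleLoop.mem_support.2 (List.mem_cons_self)⟩

variable [DecidableEq E]

open Classical in
theorem one_add_loopSum (τ : Γ.Weights) :
    1 + Γ.loopSum τ =
      collectionSum SimpleLoop.support (SimpleLoop.amplitude τ) Finset.univ := by
  have hdisj : ∀ ℓ ℓ' : Γ.SimpleLoop, Disjoint ℓ.edges ℓ'.edges ↔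
      Disjoint ℓ.support ℓ'.support := by
    intro ℓ ℓ'
    simp only [SimpleLoop.support, Set.Finite.disjoint_toFinset]
  symm
  rw [collectionSum, ← Finset.sum_filter_not_add_sum_filter _ Finset.Nonempty, loopSum, Finset.filter_filter, Finset.filter_filter]
  congr 1
  · rw [Finset.sum_eq_single ∅]
    · simp
    · intro L hL hne
      simp only [Finset.mem_filter] at hL
      exact absurd (Finset.nonempty_iff_ne_empty.2 hne) hL.2.2
    · simp
  · refine Finset.sum_congr ?_ fun _ _ => rfl
    ext L
    simp only [Finset.mem_filter, Finset.mem_univ, true_and, IsDisjointCollection, hdisj,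
      Finset.subset_univ, implies_true]
    exact and_comm

/-- The Pfaffian of `reversalMatrix - τ.matrix` is the sum over collections of disjoint loops,
and its square is the determinant. -/
theorem det_reversalMatrix_sub (τ : Γ.Weights) :
    (reversalMatrix E - Matrix.of τ.matrix).det = (1 + Γ.loopSum τ) ^ 2 := by
  classical
  set N := reversalMatrix E - Matrix.of τ.matrix with hN
  have hskew : ∀ a b, N a b = -N b a := by
    intro a b
    simp only [hN, Matrix.sub_apply, Matrix.of_apply, reversalMatrix_swap a b, τ.matrix_swap a b]
    ring
  have hB : (Matrix.toBilin' N).IsAlt := by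
    intro v
    have h : Matrix.toBilin' N v v = -Matrix.toBilin' N v v := by
      rw [Matrix.toBilin'_apply]
      conv_lhs => rw [Finset.sum_comm]
      simp only [← Finset.sum_neg_distrib]
      refine Finset.sum_congr rfl fun a _ => Finset.sum_congr rfl fun b _ => ?_
      rw [hskew b a]
      ring
    exact self_eq_neg.1 h
  set x : DirEdge E → (DirEdge E → ℂ) := fun a => Pi.single a 1 with hx
  have hBx : ∀ a b, Matrix.toBilin' N (x a) (x b) = N a b := fun a b =>
    Matrix.toBilin'_single N a b
  -- Both sides are 1 on the empty set and satisfy the same recursion on removing any edge of `S`.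
  have key : ∀ S : Finset E, pfaffianForm _ hB (edgesWedge ℂ x S) =
      collectionSum SimpleLoop.support (SimpleLoop.amplitude τ) S := by
    intro S
    induction S using Finset.strongInduction with
    | H S ih =>
    rcases S.eq_empty_or_nonempty with rfl | ⟨e, he⟩
    · rw [edgesWedge_empty, pfaffianForm_one, collectionSum, Finset.sum_eq_single ∅]
      · simp
      · intro L hL hne
        obtain ⟨ℓ, hℓ⟩ := Finset.nonempty_iff_ne_empty.2 hne
        have := (Finset.mem_filter.1 hL).2.1 ℓ hℓ
        exact absurd (Finset.subset_empty.1 this) ℓ.support_nonempty.ne_empty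
      · simp
    · have hS : insert e (S.erase e) = S := Finset.insert_erase he
      have hlt := Finset.erase_ssubset he
      rw [← hS, collectionSum_insert _ _ (Finset.notMem_erase e S),
        sum_simpleLoop_eq_sum_pathLists τ (Finset.notMem_erase e S),
        pfaffianForm_edgesWedge_insert_eq_sum _ hB x τ.matrix _ _ (Finset.notMem_erase e S),
        ih _ hlt]
      · congr 1
        refine Finset.sum_congr rfl fun m _ => ?_
        rw [ih _ (Finset.sdiff_subset.trans_ssubset hlt)]
      · intro a b hab
        have : b ≠ a.inv := by rintro rfl; exact hab rfl
        rw [hBx, hN]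
        simp [reversalMatrix, this]
      · intro e
        rw [hBx, hN]
        simp [reversalMatrix, DirEdge.inv]
  rw [one_add_loopSum, ← key, pfaffianForm_edgesWedge_univ_sq]
  congr 1
  ext a b
  rw [Matrix.of_apply, hBx]

end OrientedGraph

/-! ### Complex Gaussian integrals. -/

section ComplexGaussian

open Matrix

variable {ι : Type*} [Fintype ι]

theorem integral_cexp_neg_sum_mul_norm_sq {b : ι → ℂ} (hb : ∀ i, 0 < (b i).re) :
    ∫ v : ι → ℂ, Complex.exp (-∑ i, b i * ‖v i‖ ^ 2) = ∏ i, (Real.pi / b i) := by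
  have h := integral_fintype_prod_volume_eq_prod (𝕜 := ℂ) (ι := ι) (E := fun _ => ℂ)
    fun i z => Complex.exp (-b i * ‖z‖ ^ 2)
  simp_rw [← Complex.exp_sum, neg_mul, Finset.sum_neg_distrib, ← neg_mul] at h
  rw [h]
  refine Finset.prod_congr rfl fun i _ => ?_
  rw [GaussianFourier.integral_cexp_neg_mul_sq_norm (hb i), Complex.finrank_real_complex]
  simp

theorem dotProduct_mulVec_mulVec (M P : Matrix ι ι ℂ) (v : ι → ℂ) :
    star (P *ᵥ v) ⬝ᵥ M *ᵥ (P *ᵥ v) = star v ⬝ᵥ (Pᴴ * M * P) *ᵥ v := by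
  rw [Matrix.star_mulVec, ← Matrix.dotProduct_mulVec, Matrix.mulVec_mulVec, Matrix.mulVec_mulVec,
    Matrix.mul_assoc]

variable [DecidableEq ι]

theorem measurableEmbedding_mulVec {A : Matrix ι ι ℂ} (hA : A.det ≠ 0) :
    MeasurableEmbedding fun v : ι → ℂ => A *ᵥ v := by
  have hc : Continuous fun v : ι → ℂ => A *ᵥ v := by fun_prop
  exact hc.measurableEmbedding
    (Matrix.mulVec_injective_iff_isUnit.2 ((Matrix.isUnit_iff_isUnit_det A).2 hA.isUnit))

/-- The real Jacobian of a complex linear map is the squared modulus of its complex determinant. -/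
theorem map_mulVec_volume {A : Matrix ι ι ℂ} (hA : A.det ≠ 0) :
    Measure.map (fun v : ι → ℂ => A *ᵥ v) volume =
      ENNReal.ofReal (‖A.det‖ ^ 2)⁻¹ • (volume : Measure (ι → ℂ)) := by
  have hdet : LinearMap.det ((Matrix.toLin' A).restrictScalars ℝ) = ‖A.det‖ ^ 2 := by
    rw [LinearMap.det_restrictScalars, LinearMap.det_toLin', Algebra.norm_complex_apply,
      Complex.normSq_eq_norm_sq]
  have h := Measure.map_linearMap_addHaar_eq_smul_addHaar (volume : Measure (ι → ℂ))
    (f := (Matrix.toLin' A).restrictScalars ℝ) (by rw [hdet]; positivity)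
  rw [hdet, abs_of_nonneg (by positivity)] at h
  exact h

theorem integrable_comp_mulVec_iff {A : Matrix ι ι ℂ} (hA : A.det ≠ 0) (f : (ι → ℂ) → ℂ) :
    Integrable (fun v => f (A *ᵥ v)) ↔ Integrable f := by
  have h := (measurableEmbedding_mulVec hA).integrable_map_iff (μ := volume) (g := f)
  rw [map_mulVec_volume hA, integrable_smul_measure (by simpa using hA) ENNReal.ofReal_ne_top] at h
  exact h.symm

theorem integral_comp_mulVec {A : Matrix ι ι ℂ} (hA : A.det ≠ 0) (f : (ι → ℂ) → ℂ) :
    ∫ v, f v = ‖A.det‖ ^ 2 * ∫ v, f (A *ᵥ v) := by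
  have h := (measurableEmbedding_mulVec hA).integral_map (μ := volume) f
  rw [map_mulVec_volume hA, integral_smul_measure, ENNReal.toReal_ofReal (by positivity)] at h
  have h0 : (‖A.det‖ : ℂ) ≠ 0 := by simpa using hA
  rw [← h, Complex.real_smul]
  push_cast
  field_simp

/-- If `d k ≤ 0`, the integrand is bounded below by a positive constant on the set where `v k` is
free and the other coordinates lie in the unit ball, and that set has infinite volume. -/
theorem pos_of_integrable_exp_neg_sum {d : ι → ℝ}
    (h : Integrable fun v : ι → ℂ => Real.exp (-∑ i, d i * ‖v i‖ ^ 2)) (k : ι) : 0 < d k := by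
  by_contra! hk
  have hfin := h.measure_norm_ge_lt_top (Real.exp_pos (-∑ i, |d i|))
  refine absurd hfin (not_lt.2 (top_le_iff.2 ?_))
  refine measure_mono_top (s₁ := Set.pi Set.univ fun i : ι =>
    if i = k then Set.univ else Metric.closedBall (0 : ℂ) 1) ?_ ?_
  · intro v hv
    rw [Set.mem_ofPred_eq, Real.norm_eq_abs, Real.abs_exp, Real.exp_le_exp, neg_le_neg_iff]
    refine Finset.sum_le_sum fun i _ => ?_
    have hi := hv i (Set.mem_univ i)
    by_cases hik : i = k
    · subst hik
      exact (mul_nonpos_of_nonpos_of_nonneg hk (by positivity)).trans (abs_nonneg _)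
    · simp only [hik, if_false, mem_closedBall_zero_iff] at hi
      calc d i * ‖v i‖ ^ 2 ≤ |d i| * ‖v i‖ ^ 2 := by gcongr; exact le_abs_self _
        _ ≤ |d i| * 1 := by gcongr; exact pow_le_one₀ (norm_nonneg _) hi
        _ = |d i| := mul_one _
  · rw [volume_pi_pi]
    refine WithTop.prod_eq_top (i := k) (Finset.mem_univ k) ?_ fun i _ => ?_
    · rw [if_pos rfl]
      exact measure_univ_of_isAddLeftInvariant _
    · by_cases hik : i = k
      · rw [if_pos hik, measure_univ_of_isAddLeftInvariant]
        exact ENNReal.top_ne_zero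
      · rw [if_neg hik]
        exact (Metric.measure_closedBall_pos _ _ one_pos).ne'

theorem two_mul_re_dotProduct_mulVec {N : Matrix ι ι ℂ} {d : ι → ℝ}
    (h : N + Nᴴ = Matrix.diagonal fun i => (d i : ℂ)) (v : ι → ℂ) :
    2 * (star v ⬝ᵥ N *ᵥ v).re = ∑ i, d i * ‖v i‖ ^ 2 := by
  have h1 : star (star v ⬝ᵥ N *ᵥ v) = star v ⬝ᵥ Nᴴ *ᵥ v := by
    rw [← Matrix.star_dotProduct_star, star_star, Matrix.star_mulVec, ← Matrix.dotProduct_mulVec]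
  have h2 : star v ⬝ᵥ N *ᵥ v + star (star v ⬝ᵥ N *ᵥ v) = ((∑ i, d i * ‖v i‖ ^ 2 : ℝ) : ℂ) := by
    rw [h1, ← dotProduct_add, ← Matrix.add_mulVec, h]
    simp only [dotProduct, Matrix.mulVec_diagonal, Pi.star_apply]
    push_cast
    refine Finset.sum_congr rfl fun i _ => ?_
    rw [← Complex.conj_mul']
    simp only [RCLike.star_def]
    ring
  have h3 := congrArg Complex.re h2
  simp at h3
  simp [two_mul]
  exact_mod_cast h3

theorem Matrix.IsHermitian.exists_diagonalize {H : Matrix ι ι ℂ} (hH : H.IsHermitian) :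
    ∃ (U : Matrix ι ι ℂ) (d : ι → ℝ), Uᴴ * U = 1 ∧ U.det ≠ 0 ∧
      Uᴴ * H * U = Matrix.diagonal fun i => (d i : ℂ) := by
  have hU : (hH.eigenvectorUnitary : Matrix ι ι ℂ)ᴴ * hH.eigenvectorUnitary = 1 :=
    (Unitary.mem_iff.1 hH.eigenvectorUnitary.2).1
  refine ⟨hH.eigenvectorUnitary, hH.eigenvalues, hU, ?_, ?_⟩
  · intro h0
    have := congrArg Matrix.det hU
    rw [Matrix.det_mul, h0] at this
    simp at this
  · have h := hH.spectral_theorem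
    rw [Unitary.conjStarAlgAut_apply, Matrix.star_eq_conjTranspose] at h
    refine (congrArg (fun X => (hH.eigenvectorUnitary : Matrix ι ι ℂ)ᴴ * X *
      hH.eigenvectorUnitary) h).trans ?_
    calc _ = ((hH.eigenvectorUnitary : Matrix ι ι ℂ)ᴴ * (hH.eigenvectorUnitary : Matrix ι ι ℂ)) *
        Matrix.diagonal (RCLike.ofReal ∘ hH.eigenvalues) *
        ((hH.eigenvectorUnitary : Matrix ι ι ℂ)ᴴ * (hH.eigenvectorUnitary : Matrix ι ι ℂ)) := by
          simp only [Matrix.mul_assoc]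
      _ = _ := by rw [hU, Matrix.one_mul, Matrix.mul_one]; rfl

/-- The complex Gaussian integral `∫ exp (-⟨v, M v⟩) = πⁿ / det M`, whenever it converges
absolutely. -/
theorem integral_cexp_neg_dotProduct_mulVec {M : Matrix ι ι ℂ}
    (h : Integrable fun v : ι → ℂ => Complex.exp (-(star v ⬝ᵥ M *ᵥ v))) :
    M.det ≠ 0 ∧ ∫ v : ι → ℂ, Complex.exp (-(star v ⬝ᵥ M *ᵥ v)) =
      Real.pi ^ Fintype.card ι / M.det := by
  obtain ⟨U, d, hU, hUdet, hUd⟩ :=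
    (Matrix.isHermitian_add_transpose_self M).exists_diagonalize
  -- The modulus of the integrand depends only on the Hermitian part of `M`, which is diagonal in
  -- these coordinates; convergence makes it positive definite.
  have hd : ∀ i, 0 < d i := by
    have h1 := ((integrable_comp_mulVec_iff hUdet _).2 h).norm
    have h2 : ∀ v, ‖Complex.exp (-(star (U *ᵥ v) ⬝ᵥ M *ᵥ (U *ᵥ v)))‖ =
        Real.exp (-∑ i, d i / 2 * ‖v i‖ ^ 2) := by
      intro v
      rw [dotProduct_mulVec_mulVec, Complex.norm_exp]
      congr 1
      have := two_mul_re_dotProduct_mulVec (N := Uᴴ * M * U) (d := d) (by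
        rw [← hUd, Matrix.conjTranspose_mul, Matrix.conjTranspose_mul,
          Matrix.conjTranspose_conjTranspose, Matrix.mul_add, Matrix.add_mul, Matrix.mul_assoc,
          Matrix.mul_assoc]) v
      rw [Complex.neg_re, neg_inj]
      simp only [div_mul_eq_mul_div, ← Finset.sum_div, ← this]
      ring
    simp only [h2] at h1
    intro i
    have := pos_of_integrable_exp_neg_sum h1 i
    linarith
  -- Rescaling makes N + Nᴴ = 2. Then `1 - N` is skew-Hermitian and unitarily diagonalizable, so one
  -- congruence diagonalizes all of `M`, with entries of real part 1.
  set S : Matrix ι ι ℂ := Matrix.diagonal fun i => ((√(2 / d i) : ℝ) : ℂ) with hS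
  have hSH : Sᴴ = S := by
    rw [hS, Matrix.diagonal_conjTranspose]
    congr 1
    ext i
    simp
  set R := U * S with hR
  have hRdet : R.det ≠ 0 := by
    rw [hR, Matrix.det_mul, hS, Matrix.det_diagonal]
    refine mul_ne_zero hUdet (Finset.prod_ne_zero_iff.2 fun i _ => ?_)
    have := hd i
    exact_mod_cast (Real.sqrt_pos.2 (by positivity)).ne'
  have hRH : Rᴴ * M * R + (Rᴴ * M * R)ᴴ = (2 : ℂ) • (1 : Matrix ι ι ℂ) := by
    have : Rᴴ * M * R + (Rᴴ * M * R)ᴴ = S * (Uᴴ * (M + Mᴴ) * U) * S := by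
      simp only [hR, Matrix.conjTranspose_mul, Matrix.conjTranspose_conjTranspose, hSH,
        Matrix.mul_add, Matrix.add_mul, Matrix.mul_assoc]
    rw [this, hUd, hS, Matrix.diagonal_mul_diagonal, Matrix.diagonal_mul_diagonal,
      Matrix.smul_one_eq_diagonal]
    congr 1
    ext i
    have := hd i
    norm_cast
    rw [mul_right_comm, Real.mul_self_sqrt (by positivity)]
    field_simp
  set N := Rᴴ * M * R with hN
  have hK : (Complex.I • (1 - N)).IsHermitian := by
    rw [Matrix.IsHermitian, Matrix.conjTranspose_smul, Matrix.conjTranspose_sub,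
      Matrix.conjTranspose_one, eq_sub_of_add_eq' hRH, two_smul]
    simp only [RCLike.star_def, Complex.conj_I, neg_smul, ← smul_neg]
    congr 1
    abel
  obtain ⟨W, k, hW, hWdet, hWk⟩ := hK.exists_diagonalize
  set b : ι → ℂ := fun i => 1 + Complex.I * k i with hb
  have hWN : Wᴴ * N * W = Matrix.diagonal b := by
    have h1 : N = 1 + Complex.I • (Complex.I • (1 - N)) := by
      rw [smul_smul, Complex.I_mul_I]
      simp
    rw [h1, Matrix.mul_add, Matrix.add_mul, Matrix.mul_one, hW, Matrix.mul_smul, Matrix.smul_mul,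
      hWk, ← Matrix.diagonal_one, ← Matrix.diagonal_smul, Matrix.diagonal_add]
    rfl
  have hbre : ∀ i, 0 < (b i).re := by intro i; simp [hb]
  set P := R * W with hP
  have hPdet : P.det ≠ 0 := by
    rw [hP, Matrix.det_mul]
    exact mul_ne_zero hRdet hWdet
  have hPM : Pᴴ * M * P = Matrix.diagonal b := by
    rw [← hWN, hN, hP, Matrix.conjTranspose_mul]
    simp only [Matrix.mul_assoc]
  have hdet : (‖P.det‖ ^ 2 : ℂ) * M.det = ∏ i, b i := by
    rw [← Matrix.det_diagonal, ← hPM, Matrix.det_mul (Pᴴ * M), Matrix.det_mul Pᴴ,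
      Matrix.det_conjTranspose, ← Complex.conj_mul']
    simp only [RCLike.star_def]
    ring
  have hprod : ∏ i, b i ≠ 0 := Finset.prod_ne_zero_iff.2 fun i _ h0 => by
    have := hbre i
    simp [h0] at this
  have hMdet : M.det ≠ 0 := right_ne_zero_of_mul (hdet ▸ hprod)
  refine ⟨hMdet, ?_⟩
  rw [integral_comp_mulVec hPdet]
  have hQ : ∀ v : ι → ℂ, star (P *ᵥ v) ⬝ᵥ M *ᵥ (P *ᵥ v) = ∑ i, b i * ‖v i‖ ^ 2 := by
    intro v
    rw [dotProduct_mulVec_mulVec, hPM]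
    simp only [dotProduct, Matrix.mulVec_diagonal, Pi.star_apply]
    refine Finset.sum_congr rfl fun i _ => ?_
    rw [← Complex.conj_mul']
    simp only [RCLike.star_def]
    ring
  simp only [hQ]
  rw [integral_cexp_neg_sum_mul_norm_sq hbre, Finset.prod_div_distrib, ← hdet, Finset.prod_const,
    Finset.card_univ]
  have h0 : (‖P.det‖ : ℂ) ≠ 0 := by simpa using hPdet
  field_simp

end ComplexGaussian

/-! ### The product Gaussian measure as a density. -/

theorem MeasureTheory.Measure.pi_withDensity_ofReal {ι α : Type*} [Fintype ι] [MeasurableSpace α]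
    (μ : Measure α) [SigmaFinite μ] {f : α → ℝ} (hf : Integrable f μ) (hf0 : ∀ x, 0 ≤ f x) :
    Measure.pi (fun _ : ι => μ.withDensity fun x => ENNReal.ofReal (f x)) =
      (Measure.pi fun _ : ι => μ).withDensity fun w => ENNReal.ofReal (∏ i, f (w i)) := by
  have : IsFiniteMeasure (μ.withDensity fun x => ENNReal.ofReal (f x)) :=
    isFiniteMeasure_withDensity_ofReal hf.2
  refine Measure.pi_eq fun s hs => ?_
  rw [withDensity_apply _ (MeasurableSet.univ_pi hs), Measure.restrict_pi_pi,
    ← ofReal_integral_eq_lintegral_ofReal, integral_fintype_prod_eq_prod (𝕜 := ℝ) fun _ => f,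
    ENNReal.ofReal_prod_of_nonneg fun i _ => integral_nonneg hf0]
  · refine Finset.prod_congr rfl fun i _ => ?_
    rw [withDensity_apply _ (hs i), ofReal_integral_eq_lintegral_ofReal hf.restrict
      (Filter.Eventually.of_forall hf0)]
  · exact Integrable.fintype_prod (f := fun _ => f) fun i => hf.restrict
  · exact Filter.Eventually.of_forall fun w => Finset.prod_nonneg fun i _ => hf0 _

theorem integrable_rexp_neg_mul_norm_sq {b : ℝ} (hb : 0 < b) :
    Integrable fun z : ℂ => Real.exp (-(b * ‖z‖ ^ 2)) := by
  have h := (GaussianFourier.integrable_cexp_neg_mul_sq_norm_add (V := ℂ) (b := (b : ℂ))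
    (by simpa using hb) 0 0).norm
  refine h.congr (Filter.Eventually.of_forall fun z => ?_)
  simp only [Complex.norm_exp]
  congr 1
  simp [← Complex.ofReal_pow]

theorem integrable_rexp_neg_sum_mul_norm_sq {ι : Type*} [Fintype ι] {b : ℝ} (hb : 0 < b) :
    Integrable fun v : ι → ℂ => Real.exp (-(b * ∑ i, ‖v i‖ ^ 2)) := by
  have h := Integrable.fintype_prod (μ := fun _ : ι => (volume : Measure ℂ))
    (f := fun (_ : ι) (z : ℂ) => Real.exp (-(b * ‖z‖ ^ 2)))
    fun _ => integrable_rexp_neg_mul_norm_sq hb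
  simp only [← Real.exp_sum, Finset.sum_neg_distrib, ← Finset.mul_sum] at h
  exact h

theorem edgeMeasure_eq_withDensity (E : Type*) [Fintype E] :
    OrientedGraph.edgeMeasure E = (volume : Measure (E → Spinor)).withDensity fun w =>
      ENNReal.ofReal (∏ e, Real.exp (-(‖w e 0‖ ^ 2 + ‖w e 1‖ ^ 2)) / Real.pi ^ 2) := by
  refine Measure.pi_withDensity_ofReal (f := fun z : Spinor =>
    Real.exp (-(‖z 0‖ ^ 2 + ‖z 1‖ ^ 2)) / Real.pi ^ 2) volume ?_ fun z => by positivity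
  refine Integrable.div_const ?_ _
  simpa using integrable_rexp_neg_sum_mul_norm_sq (ι := Fin 2) one_pos

/-! ### The generating functional as a Gaussian integral over half-edges. -/

namespace OrientedGraph

variable {V E : Type*}

/-- The first components of the spinors carried by the directed edges. -/
noncomputable def halfEdgeCoord (w : E → Spinor) (a : DirEdge E) : ℂ := spinorAt w a 0

theorem halfEdgeCoord_true (w : E → Spinor) (e : E) : halfEdgeCoord w (e, true) = w e 0 := rfl

theorem halfEdgeCoord_false (w : E → Spinor) (e : E) :
    halfEdgeCoord w (e, false) = -(starRingEnd ℂ (w e 1)) := rfl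

/-- This makes the holomorphic brackets sesquilinear in the coordinates `halfEdgeCoord`. -/
theorem spinorAt_one (w : E → Spinor) (a : DirEdge E) :
    spinorAt w a 1 = (if a.2 then -1 else 1) * star (halfEdgeCoord w a.inv) := by
  rcases a with ⟨e, _ | _⟩ <;> simp [spinorAt, DirEdge.inv, halfEdgeCoord, Spinor.check]

theorem sum_norm_sq_halfEdgeCoord [Fintype E] (w : E → Spinor) :
    ∑ a, ‖halfEdgeCoord w a‖ ^ 2 = ∑ e, (‖w e 0‖ ^ 2 + ‖w e 1‖ ^ 2) := by
  rw [Fintype.sum_prod_type]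
  refine Finset.sum_congr rfl fun e _ => ?_
  simp [halfEdgeCoord_true, halfEdgeCoord_false]

theorem measurePreserving_halfEdgeCoord [Fintype E] :
    MeasurePreserving (halfEdgeCoord : (E → Spinor) → DirEdge E → ℂ) := by
  have hneg : MeasurePreserving (fun z : ℂ => -(starRingEnd ℂ z)) :=
    (Measure.measurePreserving_neg volume).comp Complex.conjLIE.measurePreserving
  have hmeas : Measurable (halfEdgeCoord : (E → Spinor) → DirEdge E → ℂ) := by
    refine measurable_pi_lambda _ fun a => ?_
    rcases a with ⟨e, _ | _⟩
    · simp only [halfEdgeCoord_false]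
      exact hneg.measurable.comp ((measurable_pi_apply 1).comp (measurable_pi_apply e))
    · simp only [halfEdgeCoord_true]
      exact (measurable_pi_apply 0).comp (measurable_pi_apply e)
  refine ⟨hmeas, (Measure.pi_eq fun s hs => ?_).symm⟩
  rw [Measure.map_apply hmeas (MeasurableSet.univ_pi hs)]
  have hpre : halfEdgeCoord ⁻¹' Set.univ.pi s = Set.univ.pi fun e : E =>
      Set.univ.pi ![s (e, true), (fun z : ℂ => -(starRingEnd ℂ z)) ⁻¹' s (e, false)] := by
    ext w
    simp only [Set.mem_preimage, Set.mem_pi, Set.mem_univ, true_imp_iff, Prod.forall,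
      Bool.forall_bool, Fin.forall_fin_two, halfEdgeCoord_true, halfEdgeCoord_false]
    exact forall_congr' fun e => and_comm
  rw [hpre, volume_pi_pi, Fintype.prod_prod_type]
  refine Finset.prod_congr rfl fun e _ => ?_
  rw [volume_pi_pi, Fin.prod_univ_two, Fintype.prod_bool]
  simp [hneg.measure_preimage (hs (e, false)).nullMeasurableSet]

/-- The two terms of each bracket supply the pairs (i, j) and (j, i). The unrestricted double sum no
longer depends on the order of the edges. -/
theorem sum_Ioi_mul_bracket {n : ℕ} {τ : Fin n → Fin n → ℂ} (hτ : ∀ i j, τ i j = -τ j i)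
    (z : Fin n → Spinor) :
    ∑ i, ∑ j ∈ Finset.Ioi i, τ i j * Spinor.bracket (z i) (z j) =
      ∑ i, ∑ j, τ i j * z i 0 * z j 1 := by
  have h := Finset.sum_sum_Ioi_add_eq_sum_sum_off_diag fun j i => τ i j * z i 0 * z j 1
  calc _ = ∑ i, ∑ j ∈ Finset.Ioi i, (τ i j * z i 0 * z j 1 + τ j i * z j 0 * z i 1) := by
        refine Finset.sum_congr rfl fun i _ => Finset.sum_congr rfl fun j _ => ?_
        rw [Spinor.bracket, hτ j i]
        ring
    _ = _ := h
    _ = _ := by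
        refine Finset.sum_congr rfl fun i _ => ?_
        have h0 : τ i i = 0 := self_eq_neg.1 (hτ i i)
        rw [← Finset.sum_add_sum_compl {i}]
        simp [h0]

theorem integrand_eq [Fintype V] [Fintype E] (Γ : OrientedGraph V E) (τ : Γ.Weights) (n : V → ℕ)
    (ord : ∀ v, Fin (n v) ≃ Γ.Star v) (w : E → Spinor) :
    Γ.integrand τ n ord w =
      Complex.exp (∑ a, ∑ b, τ.matrix a b * spinorAt w a 0 * spinorAt w b 1) := by
  classical
  simp only [integrand, vertexIntertwiner, Spinor.genIntertwiner, ← Complex.exp_sum]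
  congr 1
  rw [← Finset.sum_fiberwise Finset.univ Γ.s]
  refine Finset.sum_congr rfl fun v _ => ?_
  rw [sum_Ioi_mul_bracket fun i j => τ.antisymm v _ _ (ord v i).2 (ord v j).2]
  rw [Equiv.sum_comp (ord v) fun a : Γ.Star v => ∑ j, τ.val v a.1 (ord v j).1 *
    spinorAt w a.1 0 * spinorAt w (ord v j).1 1]
  rw [Finset.sum_subtype (p := fun a => Γ.s a = v) _ (by simp)]
  refine Finset.sum_congr rfl fun a _ => ?_
  rw [Equiv.sum_comp (ord v) fun b : Γ.Star v => τ.val v a.1 b.1 *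
    spinorAt w a.1 0 * spinorAt w b.1 1]
  rw [← Finset.sum_subtype (p := fun b => Γ.s b = v) (Finset.univ.filter fun b => Γ.s b = v)
    (by simp) fun b => τ.val v a.1 b * spinorAt w a.1 0 * spinorAt w b 1, Finset.sum_filter]
  refine Finset.sum_congr rfl fun b _ => ?_
  rw [Weights.matrix, a.2, eq_comm (a := v)]
  split_ifs <;> simp

open Matrix

/-- The matrix of the quadratic form in the exponent of the generating functional. -/
noncomputable def Weights.gaussMatrix [Fintype E] [DecidableEq E] {Γ : OrientedGraph V E}
    (τ : Γ.Weights) : Matrix (DirEdge E) (DirEdge E) ℂ :=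
  (reversalMatrix E)ᵀ * (reversalMatrix E - Matrix.of τ.matrix)

variable [Fintype E] [DecidableEq E] {Γ : OrientedGraph V E} (τ : Γ.Weights)

/-- The factor Jᵀ converts the skew matrix into the sesquilinear one at no cost, since det J = 1. -/
theorem det_gaussMatrix : τ.gaussMatrix.det = (1 + Γ.loopSum τ) ^ 2 := by
  rw [Weights.gaussMatrix, Matrix.det_mul, Matrix.det_transpose, det_reversalMatrix, one_mul,
    det_reversalMatrix_sub]

theorem reversalMatrix_mulVec (u : DirEdge E → ℂ) (a : DirEdge E) :
    (reversalMatrix E *ᵥ u) a = (if a.2 then 1 else -1) * u a.inv := by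
  simp [Matrix.mulVec, dotProduct, reversalMatrix]

theorem dotProduct_gaussMatrix_mulVec (u : DirEdge E → ℂ) :
    star u ⬝ᵥ τ.gaussMatrix *ᵥ u = ∑ a, (‖u a‖ : ℂ) ^ 2 -
      ∑ b, ∑ a, (if b.2 then 1 else -1) * star (u b.inv) * (τ.matrix b a * u a) := by
  have hstar : ∀ a, (reversalMatrix E *ᵥ star u) a = (if a.2 then 1 else -1) * star (u a.inv) :=
    fun a => reversalMatrix_mulVec _ _
  rw [Weights.gaussMatrix, ← Matrix.mulVec_mulVec, Matrix.dotProduct_mulVec,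
    Matrix.vecMul_transpose, Matrix.sub_mulVec, dotProduct_sub]
  congr 1
  · simp only [dotProduct, hstar, reversalMatrix_mulVec]
    have : Function.Involutive (DirEdge.inv : DirEdge E → DirEdge E) := DirEdge.inv_inv
    rw [← Equiv.sum_comp this.toPerm]
    refine Finset.sum_congr rfl fun a _ => ?_
    rw [← Complex.conj_mul']
    simp only [Function.Involutive.coe_toPerm, DirEdge.inv_inv, RCLike.star_def]
    rcases a with ⟨e, _ | _⟩ <;> simp [DirEdge.inv]
  · simp only [dotProduct, hstar]
    simp only [dotProduct, Matrix.mulVec, Matrix.of_apply, Finset.mul_sum]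

theorem density_mul_integrand [Fintype V] (n : V → ℕ) (ord : ∀ v, Fin (n v) ≃ Γ.Star v)
    (w : E → Spinor) :
    ((∏ e, Real.exp (-(‖w e 0‖ ^ 2 + ‖w e 1‖ ^ 2)) / Real.pi ^ 2 : ℝ) : ℂ) *
      Γ.integrand τ n ord w = ((Real.pi : ℂ) ^ Fintype.card (DirEdge E))⁻¹ *
        Complex.exp (-(star (halfEdgeCoord w) ⬝ᵥ τ.gaussMatrix *ᵥ halfEdgeCoord w)) := by
  have h1 : ∏ e, Real.exp (-(‖w e 0‖ ^ 2 + ‖w e 1‖ ^ 2)) / Real.pi ^ 2 =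
      (Real.pi ^ Fintype.card (DirEdge E))⁻¹ *
        Real.exp (-∑ a, ‖halfEdgeCoord w a‖ ^ 2) := by
    rw [Finset.prod_div_distrib, ← Real.exp_sum, Finset.sum_neg_distrib, sum_norm_sq_halfEdgeCoord,
      Finset.prod_const, Fintype.card_prod, Fintype.card_bool, Finset.card_univ, ← pow_mul,
      mul_comm 2, div_eq_inv_mul]
  rw [h1, integrand_eq, dotProduct_gaussMatrix_mulVec]
  push_cast
  rw [mul_assoc, ← Complex.exp_add]
  congr 2
  rw [neg_sub, sub_eq_add_neg, add_comm, add_left_inj, Finset.sum_comm]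
  refine Finset.sum_congr rfl fun b _ => Finset.sum_congr rfl fun a _ => ?_
  rw [spinorAt_one, τ.matrix_swap, halfEdgeCoord]
  split_ifs <;> simp [halfEdgeCoord] <;> ring

theorem continuous_cexp_gaussMatrix :
    Continuous fun u : DirEdge E → ℂ => Complex.exp (-(star u ⬝ᵥ τ.gaussMatrix *ᵥ u)) := by
  fun_prop

theorem integrable_integrand_iff [Fintype V] (n : V → ℕ) (ord : ∀ v, Fin (n v) ≃ Γ.Star v) :
    Integrable (Γ.integrand τ n ord) (edgeMeasure E) ↔
      Integrable fun u : DirEdge E → ℂ => Complex.exp (-(star u ⬝ᵥ τ.gaussMatrix *ᵥ u)) := by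
  rw [edgeMeasure_eq_withDensity, integrable_withDensity_iff_integrable_smul' (by fun_prop)
    (Filter.Eventually.of_forall fun _ => ENNReal.ofReal_lt_top)]
  rw [← measurePreserving_halfEdgeCoord.integrable_comp
    (continuous_cexp_gaussMatrix τ).aestronglyMeasurable]
  have hpi : ((Real.pi : ℂ) ^ Fintype.card (DirEdge E))⁻¹ ≠ 0 := by
    simp [Real.pi_ne_zero]
  rw [← integrable_const_mul_iff hpi.isUnit ((fun u : DirEdge E → ℂ =>
    Complex.exp (-(star u ⬝ᵥ τ.gaussMatrix *ᵥ u))) ∘ halfEdgeCoord)]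
  refine iff_of_eq (congrArg (fun f => Integrable f volume) (funext fun w => ?_))
  rw [ENNReal.toReal_ofReal (by positivity), Complex.real_smul, density_mul_integrand]
  rfl

theorem genFunctional_eq [Fintype V] (n : V → ℕ) (ord : ∀ v, Fin (n v) ≃ Γ.Star v) :
    Γ.genFunctional τ n ord = ((Real.pi : ℂ) ^ Fintype.card (DirEdge E))⁻¹ *
      ∫ u : DirEdge E → ℂ, Complex.exp (-(star u ⬝ᵥ τ.gaussMatrix *ᵥ u)) := by
  rw [genFunctional, edgeMeasure_eq_withDensity, integral_withDensity_eq_integral_toReal_smul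
    (by fun_prop) (Filter.Eventually.of_forall fun _ => ENNReal.ofReal_lt_top)]
  rw [← measurePreserving_halfEdgeCoord.map_eq,
    integral_map measurePreserving_halfEdgeCoord.measurable.aemeasurable
      (continuous_cexp_gaussMatrix τ).aestronglyMeasurable, ← integral_const_mul]
  refine integral_congr_ae (Filter.Eventually.of_forall fun w => ?_)
  simp only
  rw [ENNReal.toReal_ofReal (by positivity), Complex.real_smul, density_mul_integrand]

/-- The form is ∑ ‖u a‖² minus a perturbation. By Cauchy–Schwarz the perturbation is at most half of
that sum, so a Gaussian dominates the integrand. -/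
theorem integrable_cexp_gaussMatrix_of_small
    (h : ∀ a b, ‖τ.matrix a b‖ ≤ (2 * (Fintype.card (DirEdge E) + 1) : ℝ)⁻¹) :
    Integrable fun u : DirEdge E → ℂ => Complex.exp (-(star u ⬝ᵥ τ.gaussMatrix *ᵥ u)) := by
  refine (integrable_rexp_neg_sum_mul_norm_sq (ι := DirEdge E) one_half_pos).mono'
    (continuous_cexp_gaussMatrix τ).aestronglyMeasurable (Filter.Eventually.of_forall fun u => ?_)
  rw [Complex.norm_exp, Real.exp_le_exp, Complex.neg_re, neg_le_neg_iff,
    dotProduct_gaussMatrix_mulVec, Complex.sub_re]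
  set c : ℝ := (2 * (Fintype.card (DirEdge E) + 1) : ℝ)⁻¹ with hc
  set N : ℝ := ∑ a, ‖u a‖ ^ 2 with hN
  have hN0 : 0 ≤ N := Finset.sum_nonneg fun a _ => by positivity
  have h1 : (∑ a, (‖u a‖ : ℂ) ^ 2).re = N := by
    rw [hN, ← Complex.ofReal_re (∑ a, ‖u a‖ ^ 2)]
    push_cast
    rfl
  have hsum : ∑ b : DirEdge E, ‖u b.inv‖ = ∑ a, ‖u a‖ :=
    Equiv.sum_comp (Function.Involutive.toPerm DirEdge.inv DirEdge.inv_inv) fun a => ‖u a‖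
  have h2 : (∑ b : DirEdge E, ∑ a : DirEdge E, (if b.2 then (1 : ℂ) else -1) * star (u b.inv) *
      (τ.matrix b a * u a)).re ≤ c * (Fintype.card (DirEdge E) * N) :=
    calc _ ≤ _ := Complex.re_le_norm _
      _ ≤ ∑ b : DirEdge E, ∑ a : DirEdge E, ‖u b.inv‖ * (c * ‖u a‖) := by
        refine norm_sum_le_of_le _ fun b _ => norm_sum_le_of_le _ fun a _ => ?_
        rw [norm_mul, norm_mul, norm_mul, norm_star]
        have : ‖(if b.2 then (1 : ℂ) else -1)‖ = 1 := by split_ifs <;> simp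
        rw [this, one_mul]
        gcongr
        exact h b a
      _ = c * (∑ a, ‖u a‖) ^ 2 := by
        simp only [← Finset.mul_sum, ← Finset.sum_mul]
        rw [hsum]
        ring
      _ ≤ _ := by
        gcongr
        exact sq_sum_le_card_mul_sum_sq
  have h3 : c * (Fintype.card (DirEdge E) * N) ≤ 1 / 2 * N := by
    rw [← mul_assoc]
    gcongr
    rw [hc, inv_mul_le_iff₀ (by positivity)]
    linarith
  rw [h1]
  linarith

end OrientedGraph

/-! ### The theorem. -/

theorem mainTheorem2 {V E : Type*} [Fintype V] [Fintype E] (Γ : OrientedGraph V E)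
    (n : V → ℕ) (ord : ∀ v, Fin (n v) ≃ Γ.Star v) :
    (∃ ε : ℝ, 0 < ε ∧ ∀ τ : Γ.Weights,
      (∀ v a b, Γ.s a = v → Γ.s b = v → ‖τ.val v a b‖ < ε) →
        Integrable (Γ.integrand τ n ord) (OrientedGraph.edgeMeasure E)) ∧
    ∀ τ : Γ.Weights, Integrable (Γ.integrand τ n ord) (OrientedGraph.edgeMeasure E) →
      1 + Γ.loopSum τ ≠ 0 ∧ Γ.genFunctional τ n ord = 1 / (1 + Γ.loopSum τ) ^ 2 := by
  classical
  -- The `+ 1` keeps the bound positive for a graph without edges.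
  refine ⟨⟨(2 * (Fintype.card (DirEdge E) + 1) : ℝ)⁻¹, by positivity, fun τ hτ => ?_⟩,
    fun τ hτ => ?_⟩
  · rw [OrientedGraph.integrable_integrand_iff]
    refine OrientedGraph.integrable_cexp_gaussMatrix_of_small τ fun a b => ?_
    unfold OrientedGraph.Weights.matrix
    split_ifs with hab
    · exact (hτ _ a b rfl hab.symm).le
    · rw [norm_zero]
      positivity
  · rw [OrientedGraph.integrable_integrand_iff] at hτ
    obtain ⟨hdet, hint⟩ := integral_cexp_neg_dotProduct_mulVec hτ
    rw [OrientedGraph.det_gaussMatrix] at hdet hint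
    refine ⟨fun h0 => hdet (by rw [h0]; simp), ?_⟩
    have hpi : (Real.pi : ℂ) ^ Fintype.card (DirEdge E) ≠ 0 := by simp [Real.pi_ne_zero]
    rw [OrientedGraph.genFunctional_eq, hint]
    field_simp
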